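/- Let $\tau=(1+\sqrt5)/2$, let $\kappa\ge 0$ and $\omega>0$, and let $\mathcal I=\{(0,\pm\tau,\pm1),(\pm1,0,\pm\tau),(\pm\tau,\pm1,0)\}\subset\mathbb R^3$ be the set of vertices of the icosahedron. Let $R_+$ be the 15 positive roots of $H_3$, \[ R_+=\{(2,0,0),(0,2,0),(0,0,2),(\tau,\pm\tau^{-1},\pm1),(\pm1,\tau,\pm\tau^{-1}),(\tau^{-1},\pm1,\tau),(-\tau^{-1},1,\tau),(\tau^{-1},1,-\tau)\} \] (independent signs), and write $x\sigma_v=x-2\frac{\langle x,v\rangle}{|v|^2}v$. On polynomials in $x_1,x_2,x_3$ let \[ \mathcal D_i f(x)=\frac{\partial f}{\partial x_i}(x)+\kappa\sum_{v\in R_+}\frac{f(x)-f(x\sigma_v)}{\langle x,v\rangle}v_i,\qquad \Delta_\kappa=\sum_{i=1}^3\mathcal D_i^2 , \] and let \[ \langle f,g\rangle_2=c_{\kappa,\omega}\int_{\mathbb R^3}f(x)g(x)e^{-\omega|x|^2}\prod_{v\in R_+}|\langle x,v\rangle|^{2\kappa}\,dx,\qquad c_{\kappa,\omega}^{-1}=\int_{\mathbb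 R^3}e^{-\omega|x|^2}\prod_{v\in R_+}|\langle x,v\rangle|^{2\kappa}\,dx,\qquad \|f\|_2=\langle f,f\rangle_2^{1/2}. \] For $y_0\in\mathcal I$ define the polynomials $q_n(x;y_0)$ by $(1-r\langle x,y_0\rangle)^{-1}\prod_{y\in\mathcal I}(1-r\langle x,y\rangle)^{-\kappa}=\sum_{n\ge0}q_n(x;y_0)r^n$, and let $w_n(\cdot;y_0)=\exp\!\left(-\frac{\Delta_\kappa}{4\omega}\right)q_n(\cdot;y_0)$ (the exponential series terminates on polynomials). With the Pochhammer symbol $(a)_n=a(a+1)\cdots(a+n-1)$ put \[ \nu(n)=2^n(6\kappa+1)_{\lfloor n/2\rfloor}\left(5\kappa+\tfrac12\right)_{\lfloor (n+1)/2\rfloor}, \] \[ Y_n^{(0)}=\sum_{j=0}^n\frac{(\kappa+1)_j(5\kappa)_{n-j}}{j!\,(n-j)!}5^j,\qquad Y_n^{(1)}=\sum_{j=0}^n\frac{(\kappa)_j(5\kappa+1)_{n-j}}{j!\,(n-j)!}5^j . \] Then for every $y_0\in\mathcal I$ and every $n\ge0$: \[ w_n(x;y_0)=\sum_{j=0}^{\lfloor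 n/2\rfloor}(-1)^j\frac{(\tau+2)^j}{(4\omega)^j j!}\,\frac{\nu(n)}{\nu(n-2j)}\,q_{n-2j}(x;y_0), \] \[ \|w_{2n}(\cdot;y_0)\|_2^2=(2\omega)^{-2n}\nu(2n)\tau^{2n}Y_n^{(0)},\qquad \|w_{2n+1}(\cdot;y_0)\|_2^2=(2\omega)^{-2n-1}\nu(2n+1)(\tau+2)\tau^{2n}Y_n^{(0)}, \] and if $y_1\in\mathcal I$ satisfies $\langle y_0,y_1\rangle=\tau$, then \[ \langle w_{2n}(\cdot;y_0),w_{2n}(\cdot;y_1)\rangle_2=(2\omega)^{-2n}\nu(2n)\tau^{2n}Y_n^{(1)},\qquad \langle w_{2n+1}(\cdot;y_0),w_{2n+1}(\cdot;y_1)\rangle_2=(2\omega)^{-2n-1}\nu(2n+1)\tau^{2n+1}Y_n^{(1)} . \] -/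

import Mathlib

open scoped Matrix

noncomputable section

namespace IcosahedralOscillator

open MvPolynomial

/-- Real polynomials in `x₁, x₂, x₃`. -/
abbrev Poly : Type := MvPolynomial (Fin 3) ℝ

/-- The golden ratio `τ = (1 + √5) / 2`. -/
abbrev τ : ℝ := Real.goldenRatio

/-- The fifteen positive roots of the root system `H₃`. -/
def posRoot : Fin 15 → Fin 3 → ℝ :=
  ![![2, 0, 0], ![0, 2, 0], ![0, 0, 2],
    ![τ, τ⁻¹, 1], ![τ, τ⁻¹, -1], ![τ, -τ⁻¹, 1], ![τ, -τ⁻¹, -1],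
    ![1, τ, τ⁻¹], ![1, τ, -τ⁻¹], ![-1, τ, τ⁻¹], ![-1, τ, -τ⁻¹],
    ![τ⁻¹, 1, τ], ![τ⁻¹, -1, τ], ![-τ⁻¹, 1, τ], ![τ⁻¹, 1, -τ]]

/-- The twelve vertices of the regular icosahedron, listed without repetition. -/
def vertex : Fin 12 → Fin 3 → ℝ :=
  ![![0, τ, 1], ![0, τ, -1], ![0, -τ, 1], ![0, -τ, -1],
    ![1, 0, τ], ![1, 0, -τ], ![-1, 0, τ], ![-1, 0, -τ],
    ![τ, 1, 0], ![τ, -1, 0], ![-τ, 1, 0], ![-τ, -1, 0]]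

/-- The vertex set of the regular icosahedron. -/
def icosahedron : Set (Fin 3 → ℝ) := Set.range vertex

/-- The linear form `⟨x, v⟩` as a polynomial in `x`. -/
def linForm (v : Fin 3 → ℝ) : Poly := ∑ i, C (v i) * X i

/-- The action `f(x) ↦ f(x σ_v)` of the reflection `x σ_v = x - 2 (⟨x, v⟩ / |v|²) v`. -/
def reflect (v : Fin 3 → ℝ) : Poly →ₐ[ℝ] Poly :=
  aeval fun i => X i - C (2 * v i / (v ⬝ᵥ v)) * linForm v

theorem linForm_dvd_sub_reflect (v : Fin 3 → ℝ) (f : Poly) :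
    linForm v ∣ f - reflect v f := by
  induction f using MvPolynomial.induction_on with
  | C a => simp [reflect, ← MvPolynomial.algebraMap_eq]
  | add p q hp hq =>
    have h := dvd_add hp hq
    rw [map_add]
    convert h using 1
    ring
  | mul_X p i hp =>
    have hX : reflect v (X i) = X i - C (2 * v i / (v ⬝ᵥ v)) * linForm v := by
      simp [reflect]
    rw [map_mul, hX]
    have h : p * X i - reflect v p * (X i - C (2 * v i / (v ⬝ᵥ v)) * linForm v)
        = (p - reflect v p) * X i
          + linForm v * (reflect v p * C (2 * v i / (v ⬝ᵥ v))) := by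
      ring
    rw [h]
    exact dvd_add (Dvd.dvd.mul_right hp _) (dvd_mul_right _ _)

/-- The polynomial `(f(x) - f(x σ_v)) / ⟨x, v⟩` (unique for `v ≠ 0`). -/
def divDiff (v : Fin 3 → ℝ) (f : Poly) : Poly :=
  Classical.choose (linForm_dvd_sub_reflect v f)

theorem linForm_mul_divDiff (v : Fin 3 → ℝ) (f : Poly) :
    linForm v * divDiff v f = f - reflect v f :=
  (Classical.choose_spec (linForm_dvd_sub_reflect v f)).symm

/-- The Dunkl operator
`𝒟ᵢ f(x) = ∂f/∂xᵢ + κ ∑_v vᵢ (f(x) - f(x σ_v)) / ⟨x, v⟩`, the sum over the positive roots. -/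
def dunkl (κ : ℝ) (i : Fin 3) (f : Poly) : Poly :=
  pderiv i f + ∑ k, C (κ * posRoot k i) * divDiff (posRoot k) f

/-- The Dunkl Laplacian `Δ_κ = 𝒟₁² + 𝒟₂² + 𝒟₃²`. -/
def dunklLaplacian (κ : ℝ) (f : Poly) : Poly :=
  ∑ i, dunkl κ i (dunkl κ i f)

/-- The operator `exp(s Δ_κ)` on polynomials, given by the exponential series
`∑_j (s^j / j!) Δ_κ^j f`; it terminates on every polynomial because `Δ_κ` lowers degrees. -/
def expDunklLaplacian (κ s : ℝ) (f : Poly) : Poly :=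
  ∑ᶠ j : ℕ, C (s ^ j / (j.factorial : ℝ)) * (dunklLaplacian κ)^[j] f

/-- The expansion of `(1 - r a)^s` as a power series in `r` (binomial series). -/
def oneSubPow (a : Poly) (s : ℝ) : PowerSeries Poly :=
  PowerSeries.rescale (-a) (PowerSeries.binomialSeries Poly s)

/-- The generating function
`F(r, x; y₀) = (1 - r⟨x, y₀⟩)⁻¹ ∏_y (1 - r⟨x, y⟩)^(-κ)`, as a power series in `r` with
polynomial coefficients in `x`; the product is over the vertices of the icosahedron. -/
def genF (κ : ℝ) (y₀ : Fin 3 → ℝ) : PowerSeries Poly :=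
  oneSubPow (linForm y₀) (-1) * ∏ k, oneSubPow (linForm (vertex k)) (-κ)

/-- The polynomial `qₙ(x; y₀)`, the coefficient of `rⁿ` in `F(r, x; y₀)`. -/
def q (κ : ℝ) (n : ℕ) (y₀ : Fin 3 → ℝ) : Poly :=
  PowerSeries.coeff n (genF κ y₀)

/-- The wavefunction polynomial `wₙ(·; y₀) = exp(-Δ_κ / (4ω)) qₙ(·; y₀)`. -/
def w (κ ω : ℝ) (n : ℕ) (y₀ : Fin 3 → ℝ) : Poly :=
  expDunklLaplacian κ (-1 / (4 * ω)) (q κ n y₀)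

/-- The Pochhammer symbol `(a)ₙ = a (a + 1) ⋯ (a + n - 1)`. -/
def poch (a : ℝ) (n : ℕ) : ℝ := (ascPochhammer ℝ n).eval a

/-- `ν(n) = 2ⁿ (6κ + 1)_s (5κ + 1/2)_t` with `s = ⌊n/2⌋`, `t = ⌊(n+1)/2⌋`. -/
def ν (κ : ℝ) (n : ℕ) : ℝ :=
  2 ^ n * poch (6 * κ + 1) (n / 2) * poch (5 * κ + 1 / 2) ((n + 1) / 2)

/-- `Yₙ⁽⁰⁾ = ∑_{j=0}^n (κ+1)_j (5κ)_{n-j} 5^j / (j! (n-j)!)`. -/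
def Y0 (κ : ℝ) (n : ℕ) : ℝ :=
  ∑ j ∈ Finset.range (n + 1),
    poch (κ + 1) j * poch (5 * κ) (n - j)
      / ((j.factorial : ℝ) * ((n - j).factorial : ℝ)) * 5 ^ j

/-- `Yₙ⁽¹⁾ = ∑_{j=0}^n (κ)_j (5κ+1)_{n-j} 5^j / (j! (n-j)!)`. -/
def Y1 (κ : ℝ) (n : ℕ) : ℝ :=
  ∑ j ∈ Finset.range (n + 1),
    poch κ j * poch (5 * κ + 1) (n - j)
      / ((j.factorial : ℝ) * ((n - j).factorial : ℝ)) * 5 ^ j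

/-- `h_κ(x) = ∏_v |⟨x, v⟩|^κ`, the product over the positive roots. -/
def hWeight (κ : ℝ) (x : Fin 3 → ℝ) : ℝ := ∏ k, |x ⬝ᵥ posRoot k| ^ κ

/-- The normalization constant `c_{κ,ω}`, with
`c_{κ,ω}⁻¹ = ∫ exp(-ω|x|²) h_κ(x)² dx` over `ℝ³`. -/
def normConst (κ ω : ℝ) : ℝ :=
  (∫ x : Fin 3 → ℝ, Real.exp (-ω * (x ⬝ᵥ x)) * hWeight κ x ^ 2)⁻¹

/-- `⟨f, g⟩₂ = c_{κ,ω} ∫ f(x) g(x) exp(-ω|x|²) h_κ(x)² dx` over `ℝ³`. -/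
def inner₂ (κ ω : ℝ) (f g : Poly) : ℝ :=
  normConst κ ω *
    ∫ x : Fin 3 → ℝ, eval x f * eval x g * Real.exp (-ω * (x ⬝ᵥ x)) * hWeight κ x ^ 2

/-- `‖f‖₂`, the norm of `⟨·, ·⟩₂`. -/
def norm₂ (κ ω : ℝ) (f : Poly) : ℝ := Real.sqrt (inner₂ κ ω f f)

end IcosahedralOscillator

end

/-! The generating function F is shaped so that every Dunkl operator lowers `q`. Differentiating F
gives a sum over all twelve vertices. A reflection along v moving y₀ to y contributes a divided
difference in which ⟨x, v⟩ cancels against ⟨x, y₀ - y⟩. Five of the fifteen reflections fix y₀ and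
the other ten carry it once to each vertex other than ±y₀. The vertex sums therefore cancel except
for an antipodal term, and 𝒟ᵢ qₙ = (n + 11κ + (-1)ⁿκ) (y₀)ᵢ qₙ₋₁ (`dunkl_q_succ`). The scalar is
ν(n)/ν(n-1) and |y₀|² = τ + 2, so Δ_κ^j qₙ is an explicit multiple of qₙ₋₂ⱼ. This gives the
expansion of wₙ (`w_eq`) and the same lowering rule for wₙ (`dunkl_w_succ`).

The inner products use only three properties of the weighted integral I, collected in
`OscillatorFunctional`: I(1) = 1, reflection invariance, and the adjoint 2ωxᵢ - 𝒟ᵢ of 𝒟ᵢ. The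
adjoint rule trades a factor xᵢ in front of wₙ₊₁ for lower degrees. Starting from I(wₙ) = 0 for n >
0, induction on degree shows that wₙ is orthogonal to lower degrees and that I(f wₙ) = (2ω)⁻ⁿ ν(n)
f(y₀) for f homogeneous of degree n. Hence ⟨wₙ(·; y), wₙ(·; y')⟩₂ = (2ω)⁻ⁿ ν(n) qₙ(y'; y)
(`map_w_mul_w`).

It remains to evaluate q at vertices. The products of a fixed vertex with all vertices are ±(τ + 2),
once each, and ±τ, five times each. Pairing opposite signs leaves binomial series in r², and (τ +
2)² = 5τ² turns their coefficients into Y⁽⁰⁾ and Y⁽¹⁾.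

The adjoint rule is integration by parts (`integral_adjoint`). Since |⟨x, v⟩|^(2κ) need not be
differentiable on the mirrors, it is first replaced by (⟨x, v⟩² + ε)^κ, and then ε tends to 0 by
dominated convergence. -/

open scoped Matrix

noncomputable section

namespace IcosahedralOscillator

/-! ### The golden integers and the tables of the icosahedral group -/

/-- The ring `ℤ[τ]`, used for computations with the coordinates of roots and vertices. -/
abbrev GoldenInt : Type := QuadraticAlgebra ℤ 1 1

/-- The embedding of `ℤ[τ]` into `ℝ`. -/
def goldenHom : GoldenInt →ₐ[ℤ] ℝ :=
  QuadraticAlgebra.lift ⟨τ, by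
    have h := Real.goldenRatio_sq
    simp only [one_smul]
    linarith [sq τ]⟩

theorem goldenHom_apply (z : GoldenInt) : goldenHom z = z.re + z.im * τ := by
  simp [goldenHom, QuadraticAlgebra.lift]

/-- The positive roots over `ℤ[τ]`. -/
def goldenRoot : Fin 15 → Fin 3 → GoldenInt :=
  ![![⟨2, 0⟩, ⟨0, 0⟩, ⟨0, 0⟩], ![⟨0, 0⟩, ⟨2, 0⟩, ⟨0, 0⟩], ![⟨0, 0⟩, ⟨0, 0⟩, ⟨2, 0⟩],
    ![⟨0, 1⟩, ⟨-1, 1⟩, ⟨1, 0⟩], ![⟨0, 1⟩, ⟨-1, 1⟩, ⟨-1, 0⟩],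
    ![⟨0, 1⟩, ⟨1, -1⟩, ⟨1, 0⟩], ![⟨0, 1⟩, ⟨1, -1⟩, ⟨-1, 0⟩],
    ![⟨1, 0⟩, ⟨0, 1⟩, ⟨-1, 1⟩], ![⟨1, 0⟩, ⟨0, 1⟩, ⟨1, -1⟩],
    ![⟨-1, 0⟩, ⟨0, 1⟩, ⟨-1, 1⟩], ![⟨-1, 0⟩, ⟨0, 1⟩, ⟨1, -1⟩],
    ![⟨-1, 1⟩, ⟨1, 0⟩, ⟨0, 1⟩], ![⟨-1, 1⟩, ⟨-1, 0⟩, ⟨0, 1⟩],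
    ![⟨1, -1⟩, ⟨1, 0⟩, ⟨0, 1⟩], ![⟨-1, 1⟩, ⟨1, 0⟩, ⟨0, -1⟩]]

/-- The vertices of the icosahedron over `ℤ[τ]`. -/
def goldenVertex : Fin 12 → Fin 3 → GoldenInt :=
  ![![⟨0, 0⟩, ⟨0, 1⟩, ⟨1, 0⟩], ![⟨0, 0⟩, ⟨0, 1⟩, ⟨-1, 0⟩],
    ![⟨0, 0⟩, ⟨0, -1⟩, ⟨1, 0⟩], ![⟨0, 0⟩, ⟨0, -1⟩, ⟨-1, 0⟩],
    ![⟨1, 0⟩, ⟨0, 0⟩, ⟨0, 1⟩], ![⟨1, 0⟩, ⟨0, 0⟩, ⟨0, -1⟩],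
    ![⟨-1, 0⟩, ⟨0, 0⟩, ⟨0, 1⟩], ![⟨-1, 0⟩, ⟨0, 0⟩, ⟨0, -1⟩],
    ![⟨0, 1⟩, ⟨1, 0⟩, ⟨0, 0⟩], ![⟨0, 1⟩, ⟨-1, 0⟩, ⟨0, 0⟩],
    ![⟨0, -1⟩, ⟨1, 0⟩, ⟨0, 0⟩], ![⟨0, -1⟩, ⟨-1, 0⟩, ⟨0, 0⟩]]

/-- Hence all root coordinates lie in ℤ[τ], where the finite facts about the group can be decided by
computation. -/
theorem inv_goldenRatio_eq : (τ)⁻¹ = τ - 1 := by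
  rw [Real.inv_goldenRatio]
  linarith [Real.goldenRatio_add_goldenConj]

theorem posRoot_eq (k : Fin 15) (i : Fin 3) : posRoot k i = goldenHom (goldenRoot k i) := by
  rw [goldenHom_apply]
  have h := inv_goldenRatio_eq
  simp only [posRoot, goldenRoot]
  generalize (τ)⁻¹ = s at h ⊢
  generalize τ = t at h ⊢
  subst h
  fin_cases k <;> fin_cases i <;> simp <;> ring

theorem vertex_eq (k : Fin 12) (i : Fin 3) : vertex k i = goldenHom (goldenVertex k i) := by
  rw [goldenHom_apply]
  fin_cases k <;> fin_cases i <;> simp [vertex, goldenVertex]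

/-- The permutation of the vertices induced by each of the fifteen reflections. -/
def vertexPerm : Fin 15 → Fin 12 → Fin 12 :=
  ![![0, 1, 2, 3, 6, 7, 4, 5, 10, 11, 8, 9],
    ![2, 3, 0, 1, 4, 5, 6, 7, 9, 8, 11, 10],
    ![1, 0, 3, 2, 5, 4, 7, 6, 8, 9, 10, 11],
    ![10, 1, 2, 9, 11, 5, 6, 8, 7, 3, 0, 4],
    ![0, 10, 9, 3, 4, 11, 8, 7, 6, 2, 1, 5],
    ![0, 8, 11, 3, 10, 5, 6, 9, 1, 7, 4, 2],
    ![8, 1, 2, 11, 4, 10, 9, 7, 0, 6, 5, 3],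
    ![11, 7, 4, 8, 2, 5, 6, 1, 3, 9, 10, 0],
    ![6, 11, 8, 5, 4, 3, 0, 7, 2, 9, 10, 1],
    ![9, 5, 6, 10, 4, 1, 2, 7, 8, 0, 3, 11],
    ![4, 9, 10, 7, 0, 5, 6, 3, 8, 1, 2, 11],
    ![7, 1, 2, 4, 3, 8, 11, 0, 5, 9, 10, 6],
    ![0, 4, 7, 3, 1, 9, 10, 2, 8, 5, 6, 11],
    ![5, 1, 2, 6, 9, 0, 3, 10, 8, 4, 7, 11],
    ![0, 6, 5, 3, 8, 2, 1, 11, 4, 9, 10, 7]]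

/-- The permutation of the positive roots, up to sign, induced by each reflection. -/
def rootPerm : Fin 15 → Fin 15 → Fin 15 :=
  ![![0, 1, 2, 6, 5, 4, 3, 9, 10, 7, 8, 13, 14, 11, 12],
    ![0, 1, 2, 5, 6, 3, 4, 10, 9, 8, 7, 12, 11, 14, 13],
    ![0, 1, 2, 4, 3, 6, 5, 8, 7, 10, 9, 14, 13, 12, 11],
    ![11, 10, 4, 3, 2, 7, 13, 5, 12, 9, 1, 0, 8, 6, 14],
    ![14, 9, 3, 2, 4, 12, 8, 13, 6, 1, 10, 11, 5, 7, 0],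
    ![12, 7, 6, 10, 14, 5, 2, 1, 8, 11, 3, 9, 0, 13, 4],
    ![13, 8, 5, 11, 9, 2, 6, 7, 1, 4, 14, 3, 12, 0, 10],
    ![9, 3, 14, 1, 13, 10, 6, 7, 11, 0, 5, 8, 12, 4, 2],
    ![10, 4, 11, 12, 1, 5, 9, 14, 8, 6, 0, 2, 3, 13, 7],
    ![7, 6, 12, 3, 8, 11, 1, 0, 4, 9, 13, 5, 2, 10, 14],
    ![8, 5, 13, 7, 4, 1, 14, 3, 0, 12, 10, 11, 9, 2, 6],
    ![6, 12, 7, 13, 4, 9, 0, 2, 14, 5, 10, 11, 1, 3, 8],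
    ![4, 11, 10, 8, 0, 14, 6, 7, 3, 13, 2, 1, 12, 9, 5],
    ![3, 14, 9, 0, 7, 5, 11, 4, 8, 2, 12, 6, 10, 13, 1],
    ![5, 13, 8, 3, 12, 0, 10, 11, 2, 9, 6, 7, 4, 1, 14]]

/-- The index of the antipodal vertex. -/
def antipode : Fin 12 → Fin 12 := ![3, 2, 1, 0, 7, 6, 5, 4, 11, 10, 9, 8]

theorem vertexPerm_bijective (k : Fin 15) : Function.Bijective (vertexPerm k) := by
  revert k; decide +kernel

theorem rootPerm_bijective (k : Fin 15) : Function.Bijective (rootPerm k) := by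
  revert k; decide +kernel

theorem antipode_bijective : Function.Bijective antipode := by decide +kernel

/-- The image `x σ_v` of `x` under the reflection along `v`. -/
def reflVec (v x : Fin 3 → ℝ) : Fin 3 → ℝ := fun i => x i - 2 * (x ⬝ᵥ v) / (v ⬝ᵥ v) * v i

theorem goldenRoot_dot_self (k : Fin 15) :
    ∑ i, goldenRoot k i * goldenRoot k i = ⟨4, 0⟩ := by
  revert k; decide +kernel

theorem posRoot_dot_self (k : Fin 15) : posRoot k ⬝ᵥ posRoot k = 4 := by
  have h := congrArg goldenHom (goldenRoot_dot_self k)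
  rw [map_sum, goldenHom_apply] at h
  simpa [dotProduct, posRoot_eq] using h

/-- Since |v|² = 4, the reflection subtracts (⟨x, v⟩ / 2) v; doubling keeps the identity inside
ℤ[τ]. -/
theorem goldenVertex_reflection (k : Fin 15) (m : Fin 12) (i : Fin 3) :
    2 * (goldenVertex m i - goldenVertex (vertexPerm k m) i) =
      (∑ j, goldenVertex m j * goldenRoot k j) * goldenRoot k i := by
  revert k m i; decide +kernel

theorem reflVec_vertex (k : Fin 15) (m : Fin 12) :
    reflVec (posRoot k) (vertex m) = vertex (vertexPerm k m) := by
  funext i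
  have h := congrArg goldenHom (goldenVertex_reflection k m i)
  simp only [map_mul, map_sub, map_sum, map_ofNat, ← posRoot_eq, ← vertex_eq] at h
  simp only [reflVec, posRoot_dot_self]
  simp only [dotProduct]
  linarith

theorem goldenRoot_reflection (k m : Fin 15) :
    (∀ i, 2 * (goldenRoot m i - goldenRoot (rootPerm k m) i) =
      (∑ j, goldenRoot m j * goldenRoot k j) * goldenRoot k i) ∨
    (∀ i, 2 * (goldenRoot m i + goldenRoot (rootPerm k m) i) =
      (∑ j, goldenRoot m j * goldenRoot k j) * goldenRoot k i) := by
  revert k m; decide +kernel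

theorem reflVec_posRoot (k m : Fin 15) :
    reflVec (posRoot k) (posRoot m) = posRoot (rootPerm k m) ∨
      reflVec (posRoot k) (posRoot m) = -posRoot (rootPerm k m) := by
  rcases goldenRoot_reflection k m with hk | hk
  · left
    funext i
    have h := congrArg goldenHom (hk i)
    simp only [map_mul, map_sub, map_sum, map_ofNat, ← posRoot_eq] at h
    simp only [reflVec, posRoot_dot_self]
    simp only [dotProduct]
    linarith
  · right
    funext i
    have h := congrArg goldenHom (hk i)
    simp only [map_mul, map_add, map_sum, map_ofNat, ← posRoot_eq] at h
    simp only [reflVec, posRoot_dot_self, Pi.neg_apply]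
    simp only [dotProduct]
    linarith

theorem goldenVertex_antipode (m : Fin 12) (i : Fin 3) :
    goldenVertex (antipode m) i = -goldenVertex m i := by
  revert m i; decide +kernel

theorem vertex_antipode (m : Fin 12) : vertex (antipode m) = -vertex m := by
  funext i
  simp [vertex_eq, goldenVertex_antipode]

/-- Each vertex is fixed by five reflections; the other ten carry it once to each vertex
different from it and its antipode. -/
theorem map_vertexPerm (m : Fin 12) :
    (Finset.univ : Finset (Fin 15)).val.map (fun k => vertexPerm k m) + {antipode m} =
      (Finset.univ : Finset (Fin 12)).val + Multiset.replicate 4 m := by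
  revert m; decide +kernel

theorem sum_vertexPerm {M : Type*} [AddCommMonoid M] (m : Fin 12) (f : Fin 12 → M) :
    ∑ k, f (vertexPerm k m) + f (antipode m) = ∑ l, f l + 4 • f m := by
  have h := congrArg (fun s => (s.map f).sum) (map_vertexPerm m)
  simp only [Multiset.map_add, Multiset.map_map, Multiset.sum_add, Multiset.map_singleton,
    Multiset.sum_singleton, Multiset.map_replicate, Multiset.sum_replicate] at h
  exact h

theorem goldenVertex_dot_self (m : Fin 12) :
    ∑ i, goldenVertex m i * goldenVertex m i = ⟨2, 1⟩ := by
  revert m; decide +kernel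

theorem vertex_dot_self (m : Fin 12) : vertex m ⬝ᵥ vertex m = τ + 2 := by
  have h := congrArg goldenHom (goldenVertex_dot_self m)
  rw [map_sum, goldenHom_apply] at h
  simp only [map_mul, ← vertex_eq] at h
  simp only [dotProduct, h]
  push_cast
  ring

theorem map_goldenVertex_dot (m : Fin 12) :
    (Finset.univ : Finset (Fin 12)).val.map
        (fun l => ∑ i, goldenVertex m i * goldenVertex l i) =
      {⟨2, 1⟩, ⟨-2, -1⟩} + Multiset.replicate 5 ⟨0, 1⟩ + Multiset.replicate 5 ⟨0, -1⟩ := by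
  revert m; decide +kernel

/-- Opposite values are grouped so that the product over vertices becomes a series in r² in
`map_eval_genF`. -/
theorem prod_vertex_dot {M : Type*} [CommMonoid M] (m : Fin 12) (f : ℝ → M) :
    ∏ l, f (vertex m ⬝ᵥ vertex l) = f (τ + 2) * f (-(τ + 2)) * (f τ * f (-τ)) ^ 5 := by
  have h := congrArg (fun s => (s.map (fun z => f (goldenHom z))).prod) (map_goldenVertex_dot m)
  have hd (l : Fin 12) : goldenHom (∑ i, goldenVertex m i * goldenVertex l i) =
      vertex m ⬝ᵥ vertex l := by
    simp [dotProduct, vertex_eq]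
  have h1 : goldenHom ⟨2, 1⟩ = τ + 2 := by rw [goldenHom_apply]; push_cast; ring
  have h2 : goldenHom ⟨-2, -1⟩ = -(τ + 2) := by rw [goldenHom_apply]; push_cast; ring
  have h3 : goldenHom ⟨0, 1⟩ = τ := by rw [goldenHom_apply]; push_cast; ring
  have h4 : goldenHom ⟨0, -1⟩ = -τ := by rw [goldenHom_apply]; push_cast; ring
  simp only [Multiset.map_map, Multiset.map_add, Multiset.prod_add, Multiset.map_replicate,
    Multiset.prod_replicate, Multiset.insert_eq_cons, Multiset.map_cons, Multiset.prod_cons,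
    Multiset.map_singleton, Multiset.prod_singleton, h1, h2, h3, h4, Function.comp_def, hd] at h
  rw [mul_pow, ← mul_assoc, ← h]
  rfl

/-! ### Binomial series and coefficientwise operators -/

section PowerSeriesLemmas

open PowerSeries

variable {A B : Type*} [CommRing A] [CommRing B] [Algebra ℝ A] [Algebra ℝ B]

/-- The binomial series of `(1 - a X) ^ s` over a real algebra. -/
def oneSubSeries (a : A) (s : ℝ) : PowerSeries A :=
  rescale (-a) (binomialSeries A s)

theorem coeff_oneSubSeries (a : A) (s : ℝ) (n : ℕ) :
    coeff n (oneSubSeries a s) = Ring.choose s n • (-a) ^ n := by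
  simp [oneSubSeries, coeff_rescale]

theorem oneSubSeries_add (a : A) (s t : ℝ) :
    oneSubSeries a (s + t) = oneSubSeries a s * oneSubSeries a t := by
  simp [oneSubSeries]

theorem oneSubSeries_one (a : A) : oneSubSeries a 1 = 1 - C a * X := by
  have h := binomialSeries_nat (R := ℝ) (A := A) 1
  rw [Nat.cast_one] at h
  rw [oneSubSeries, h]
  simp [rescale_X, sub_eq_add_neg]

theorem oneSubSeries_zero (a : A) : oneSubSeries a 0 = 1 := by
  simp [oneSubSeries]

theorem one_sub_mul_oneSubSeries (a : A) : (1 - C a * X) * oneSubSeries a (-1) = 1 := by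
  rw [← oneSubSeries_one, ← oneSubSeries_add, add_neg_cancel, oneSubSeries_zero]

theorem map_oneSubSeries (φ : A →ₐ[ℝ] B) (a : A) (s : ℝ) :
    PowerSeries.map (φ : A →+* B) (oneSubSeries a s) = oneSubSeries (φ a) s := by
  ext n
  simp [coeff_oneSubSeries]

theorem rescale_neg_one_oneSubSeries (a : A) (s : ℝ) :
    rescale (-1) (oneSubSeries a s) = oneSubSeries (-a) s := by
  simp [oneSubSeries, rescale_rescale]

theorem succ_mul_choose (s : ℝ) (n : ℕ) :
    (n + 1) * Ring.choose s (n + 1) = s * Ring.choose (s - 1) n := by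
  have h := Ring.choose_smul_choose s (Nat.le_add_left 1 n)
  simpa [nsmul_eq_mul] using h

/-- A derivation applied to each coefficient of a power series. -/
def coeffDerivation (D : Derivation ℝ A A) : Derivation ℝ (PowerSeries A) (PowerSeries A) :=
  Derivation.mk'
    { toFun := fun f => PowerSeries.mk fun n => D (coeff n f)
      map_add' := fun f g => by ext n; simp
      map_smul' := fun c f => by ext n; simp }
    (fun f g => by
      ext n
      simp only [LinearMap.coe_mk, AddHom.coe_mk, coeff_mk, coeff_mul, map_sum, Derivation.leibniz,
        smul_eq_mul, map_add, Finset.sum_add_distrib]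
      congr 1
      rw [← Finset.Nat.sum_antidiagonal_swap]
      rfl)

theorem coeff_coeffDerivation (D : Derivation ℝ A A) (f : PowerSeries A) (n : ℕ) :
    coeff n (coeffDerivation D f) = D (coeff n f) := by
  simp [coeffDerivation]

/-- The chain rule in logarithmic form: the factor multiplying the series is its logarithmic
derivative, so these factors add up over a product. -/
theorem coeffDerivation_oneSubSeries (D : Derivation ℝ A A) (a : A) (s : ℝ) :
    coeffDerivation D (oneSubSeries a s) =
      -(s • (C (D a) * X * oneSubSeries a (-1))) * oneSubSeries a s := by
  have h : coeffDerivation D (oneSubSeries a s) =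
      -(s • (C (D a) * (X * oneSubSeries a (s - 1)))) := by
    ext n
    rw [coeff_coeffDerivation, coeff_oneSubSeries]
    cases n with
    | zero => simp
    | succ n =>
      simp only [map_neg, coeff_smul, coeff_C_mul, coeff_succ_X_mul, coeff_oneSubSeries]
      rw [Derivation.map_smul, Derivation.leibniz_pow, map_neg, Nat.add_sub_cancel]
      simp only [smul_eq_mul, Algebra.smul_def]
      have h := congrArg (algebraMap ℝ A) (succ_mul_choose s n)
      push_cast [map_mul, map_add, map_natCast, map_one] at h ⊢
      linear_combination (-(-a) ^ n * D a) * h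
  rw [h, show s - 1 = -1 + s by ring, oneSubSeries_add]
  simp only [Algebra.smul_def]
  ring

theorem derivative_oneSubSeries (a : A) (s : ℝ) :
    d⁄dX A (oneSubSeries a s) = -(s • (C a * oneSubSeries a (-1))) * oneSubSeries a s := by
  have h : d⁄dX A (oneSubSeries a s) = -(s • (C a * oneSubSeries a (s - 1))) := by
    ext n
    rw [coeff_derivative, coeff_oneSubSeries]
    simp only [map_neg, coeff_smul, coeff_C_mul, coeff_oneSubSeries]
    simp only [Algebra.smul_def]
    have h := congrArg (algebraMap ℝ A) (succ_mul_choose s n)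
    push_cast [map_mul, map_add, map_natCast, map_one] at h ⊢
    linear_combination (-(-a) ^ n * a) * h
  rw [h, show s - 1 = -1 + s by ring, oneSubSeries_add]
  simp only [Algebra.smul_def]
  ring

theorem derivation_prod_of_eq_mul {R S ι : Type*} [CommRing R] [CommRing S] [Algebra R S]
    (D : Derivation R S S) (s : Finset ι) (f g : ι → S) (h : ∀ k ∈ s, D (f k) = g k * f k) :
    D (∏ k ∈ s, f k) = (∑ k ∈ s, g k) * ∏ k ∈ s, f k := by
  classical
  induction s using Finset.induction_on with
  | empty => simp
  | insert k s hk ih =>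
    rw [Finset.prod_insert hk, Finset.sum_insert hk, Derivation.leibniz, h k (by simp),
      ih fun l hl => h l (by simp [hl])]
    simp only [smul_eq_mul]
    ring

end PowerSeriesLemmas

/-! ### Homogeneity of the polynomials `q` -/

open MvPolynomial

theorem isHomogeneous_coeff_mul {σ : Type*} {f g : PowerSeries (MvPolynomial σ ℝ)}
    (hf : ∀ n, (PowerSeries.coeff n f).IsHomogeneous n) (hg : ∀ n, (PowerSeries.coeff n g).IsHomogeneous n) (n : ℕ) :
    (PowerSeries.coeff n (f * g)).IsHomogeneous n := by
  rw [PowerSeries.coeff_mul]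
  refine IsHomogeneous.sum _ _ _ fun p hp => ?_
  rw [← (Finset.HasAntidiagonal.mem_antidiagonal.mp hp)]
  exact (hf _).mul (hg _)

theorem linForm_isHomogeneous (v : Fin 3 → ℝ) : (linForm v).IsHomogeneous 1 :=
  IsHomogeneous.sum _ _ _ fun _ _ => isHomogeneous_C_mul_X _ _

theorem oneSubPow_eq (a : Poly) (s : ℝ) : oneSubPow a s = oneSubSeries a s := rfl

theorem coeff_oneSubPow_isHomogeneous (v : Fin 3 → ℝ) (s : ℝ) (n : ℕ) :
    (PowerSeries.coeff n (oneSubPow (linForm v) s)).IsHomogeneous n := by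
  rw [oneSubPow_eq, coeff_oneSubSeries, smul_eq_C_mul]
  have h := ((linForm_isHomogeneous v).neg.pow n).C_mul (Ring.choose s n)
  rwa [one_mul] at h

theorem q_isHomogeneous (κ : ℝ) (n : ℕ) (y : Fin 3 → ℝ) : (q κ n y).IsHomogeneous n := by
  have hprod (s : Finset (Fin 12)) (n : ℕ) :
      (PowerSeries.coeff n (∏ k ∈ s, oneSubPow (linForm (vertex k)) (-κ))).IsHomogeneous n := by
    induction s using Finset.induction_on generalizing n with
    | empty =>
      rw [Finset.prod_empty, PowerSeries.coeff_one]
      split_ifs with h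
      · exact h ▸ isHomogeneous_one _ _
      · exact isHomogeneous_zero _ _ _
    | insert k s hk ih =>
      rw [Finset.prod_insert hk]
      exact isHomogeneous_coeff_mul (coeff_oneSubPow_isHomogeneous _ _) ih n
  exact isHomogeneous_coeff_mul (coeff_oneSubPow_isHomogeneous _ _) (hprod _) n

/-! ### Reflections and divided differences of polynomials -/

theorem linForm_add (u v : Fin 3 → ℝ) : linForm (u + v) = linForm u + linForm v := by
  simp [linForm, add_mul, Finset.sum_add_distrib]

theorem linForm_smul (c : ℝ) (v : Fin 3 → ℝ) : linForm (c • v) = C c * linForm v := by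
  simp [linForm, Finset.mul_sum, mul_assoc]

theorem linForm_neg (v : Fin 3 → ℝ) : linForm (-v) = -linForm v := by
  simp [linForm]

theorem linForm_sub (u v : Fin 3 → ℝ) : linForm (u - v) = linForm u - linForm v := by
  rw [sub_eq_add_neg, linForm_add, linForm_neg, sub_eq_add_neg]

theorem eval_linForm (x v : Fin 3 → ℝ) : eval x (linForm v) = x ⬝ᵥ v := by
  simp [linForm, dotProduct, mul_comm]

theorem pderiv_linForm (i : Fin 3) (v : Fin 3 → ℝ) : pderiv i (linForm v) = C (v i) := by
  simp [linForm, pderiv_X, Pi.single_apply]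

theorem linForm_ne_zero {v : Fin 3 → ℝ} (hv : v ≠ 0) : linForm v ≠ 0 := by
  obtain ⟨i, hi⟩ := Function.ne_iff.mp hv
  intro h
  have h1 := pderiv_linForm i v
  rw [h, map_zero, eq_comm, C_eq_zero] at h1
  exact hi h1

theorem posRoot_ne_zero (k : Fin 15) : posRoot k ≠ 0 := by
  intro h
  have := posRoot_dot_self k
  rw [h] at this
  simp at this

theorem reflVec_eq (v x : Fin 3 → ℝ) : reflVec v x = x - (2 * (x ⬝ᵥ v) / (v ⬝ᵥ v)) • v := rfl

theorem reflect_linForm (v u : Fin 3 → ℝ) : reflect v (linForm u) = linForm (reflVec v u) := by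
  rw [reflVec_eq, linForm_sub, linForm_smul]
  have h : reflect v (linForm u) =
      ∑ i, C (u i) * (X i - C (2 * v i / (v ⬝ᵥ v)) * linForm v) := by
    simp [linForm, reflect, algHom_C]
  rw [h]
  simp only [mul_sub, Finset.sum_sub_distrib, ← mul_assoc, ← map_mul, ← Finset.sum_mul,
    ← map_sum]
  congr 3
  simp only [dotProduct, Finset.mul_sum, Finset.sum_div]
  congr 1
  funext i
  ring

theorem eval_reflect (v x : Fin 3 → ℝ) (f : Poly) :
    eval x (reflect v f) = eval (reflVec v x) f := by
  have h : (aeval x).comp (reflect v) = aeval (R := ℝ) (reflVec v x) := by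
    ext i
    simp [reflect, reflVec, aeval_eq_eval, eval_linForm]
    ring
  exact DFunLike.congr_fun h f

theorem reflVec_dot (v x y : Fin 3 → ℝ) : reflVec v x ⬝ᵥ y = x ⬝ᵥ reflVec v y := by
  simp only [reflVec_eq, sub_dotProduct, dotProduct_sub, smul_dotProduct, dotProduct_smul,
    smul_eq_mul]
  rw [dotProduct_comm v y]
  ring

theorem reflVec_reflVec {v : Fin 3 → ℝ} (hv : v ⬝ᵥ v ≠ 0) (x : Fin 3 → ℝ) :
    reflVec v (reflVec v x) = x := by
  simp only [reflVec_eq, sub_dotProduct, smul_dotProduct, smul_eq_mul]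
  funext i
  simp only [Pi.sub_apply, Pi.smul_apply, smul_eq_mul]
  field_simp
  ring

theorem reflVec_self {v : Fin 3 → ℝ} (hv : v ⬝ᵥ v ≠ 0) : reflVec v v = -v := by
  funext i
  simp only [reflVec, Pi.neg_apply]
  field_simp
  ring

/-- The quotient is an arbitrary choice by definition; cancelling a nonzero linear form in a domain
makes it computable. -/
theorem divDiff_eq_of_linForm_mul {v : Fin 3 → ℝ} (hv : v ≠ 0) {f g : Poly}
    (h : linForm v * g = f - reflect v f) : divDiff v f = g :=
  mul_left_cancel₀ (linForm_ne_zero hv) ((linForm_mul_divDiff v f).trans h.symm)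

theorem divDiff_add {v : Fin 3 → ℝ} (hv : v ≠ 0) (f g : Poly) :
    divDiff v (f + g) = divDiff v f + divDiff v g := by
  refine divDiff_eq_of_linForm_mul hv ?_
  rw [mul_add, linForm_mul_divDiff, linForm_mul_divDiff, map_add]
  ring

theorem divDiff_C_mul {v : Fin 3 → ℝ} (hv : v ≠ 0) (c : ℝ) (f : Poly) :
    divDiff v (C c * f) = C c * divDiff v f := by
  refine divDiff_eq_of_linForm_mul hv ?_
  rw [mul_left_comm, linForm_mul_divDiff, map_mul, algHom_C, algebraMap_eq]
  ring

theorem dunkl_add (κ : ℝ) (i : Fin 3) (f g : Poly) :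
    dunkl κ i (f + g) = dunkl κ i f + dunkl κ i g := by
  simp only [dunkl, map_add, divDiff_add (posRoot_ne_zero _), mul_add, Finset.sum_add_distrib]
  ring

theorem dunkl_C_mul (κ : ℝ) (i : Fin 3) (c : ℝ) (f : Poly) :
    dunkl κ i (C c * f) = C c * dunkl κ i f := by
  simp only [dunkl, pderiv_C_mul, divDiff_C_mul (posRoot_ne_zero _), mul_add, Finset.mul_sum]
  congr 1
  exact Finset.sum_congr rfl fun k _ => by ring

theorem dunkl_C (κ : ℝ) (i : Fin 3) (c : ℝ) : dunkl κ i (C c) = 0 := by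
  have h (k : Fin 15) : divDiff (posRoot k) (C c) = 0 := by
    refine divDiff_eq_of_linForm_mul (posRoot_ne_zero k) ?_
    rw [algHom_C, algebraMap_eq]
    ring
  simp [dunkl, h]

/-- The Dunkl operator as a linear map. -/
def dunklLin (κ : ℝ) (i : Fin 3) : Poly →ₗ[ℝ] Poly where
  toFun := dunkl κ i
  map_add' := dunkl_add κ i
  map_smul' c f := by simpa [smul_eq_C_mul] using dunkl_C_mul κ i c f

/-- The Dunkl Laplacian as a linear map. -/
def dunklLaplacianLin (κ : ℝ) : Poly →ₗ[ℝ] Poly :=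
  ∑ i, dunklLin κ i ∘ₗ dunklLin κ i

theorem dunklLaplacianLin_apply (κ : ℝ) (f : Poly) :
    dunklLaplacianLin κ f = dunklLaplacian κ f := by
  simp [dunklLaplacianLin, dunklLaplacian, dunklLin]

theorem totalDegree_divDiff_lt {v : Fin 3 → ℝ} (hv : v ≠ 0) (f : Poly) {n : ℕ}
    (hf : f.totalDegree ≤ n + 1) : (divDiff v f).totalDegree ≤ n := by
  by_cases h0 : divDiff v f = 0
  · simp [h0]
  have hr : (reflect v f).totalDegree ≤ n + 1 := by
    rw [f.as_sum, map_sum]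
    refine totalDegree_finsetSum_le fun s hs => ?_
    refine le_trans ?_ ((le_totalDegree hs).trans hf)
    rw [reflect, aeval_monomial, Finsupp.prod, algebraMap_eq]
    refine (totalDegree_mul _ _).trans ?_
    rw [totalDegree_C, zero_add]
    refine (totalDegree_finsetProd _ _).trans ?_
    refine Finset.sum_le_sum fun i _ => (totalDegree_pow _ _).trans ?_
    refine (Nat.mul_le_mul_left _ ?_).trans (mul_one _).le
    refine (totalDegree_sub _ _).trans (max_le (totalDegree_X _).le ?_)
    refine (totalDegree_mul _ _).trans ?_
    rw [totalDegree_C, zero_add]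
    exact (linForm_isHomogeneous v).totalDegree_le
  have h1 : (linForm v * divDiff v f).totalDegree ≤ n + 1 := by
    rw [linForm_mul_divDiff]
    exact (totalDegree_sub _ _).trans (max_le hf hr)
  rw [totalDegree_mul_of_isDomain (linForm_ne_zero hv) h0,
    (linForm_isHomogeneous v).totalDegree (linForm_ne_zero hv)] at h1
  omega

theorem totalDegree_pderiv_le (i : Fin 3) (f : Poly) {n : ℕ} (hf : f.totalDegree ≤ n + 1) :
    (pderiv i f).totalDegree ≤ n := by
  rw [f.as_sum, map_sum]
  refine totalDegree_finsetSum_le fun s hs => ?_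
  rw [pderiv_monomial]
  by_cases hsi : s i = 0
  · simp [hsi]
  refine (totalDegree_monomial_le _ _).trans ?_
  change ((s - Finsupp.single i 1).sum fun _ e => e) ≤ n
  have h1 := (le_totalDegree hs).trans hf
  have h2 : (s - Finsupp.single i 1) + Finsupp.single i 1 = s :=
    tsub_add_cancel_of_le (Finsupp.single_le_iff.mpr (Nat.one_le_iff_ne_zero.mpr hsi))
  have h3 := congrArg (fun t : Fin 3 →₀ ℕ => t.sum fun _ e => e) h2
  simp only [Finsupp.sum_add_index' (h := fun _ e => e) (fun _ => rfl) (fun _ _ _ => rfl),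
    Finsupp.sum_single_index] at h3
  omega

theorem totalDegree_dunkl_le (κ : ℝ) (i : Fin 3) (f : Poly) {n : ℕ}
    (hf : f.totalDegree ≤ n + 1) : (dunkl κ i f).totalDegree ≤ n := by
  refine (totalDegree_add _ _).trans (max_le (totalDegree_pderiv_le i f hf) ?_)
  refine totalDegree_finsetSum_le fun k _ => ?_
  refine (totalDegree_mul _ _).trans ?_
  rw [totalDegree_C, zero_add]
  exact totalDegree_divDiff_lt (posRoot_ne_zero k) f hf

/-! ### The action of the Dunkl operators on the polynomials `q` -/

section GeneratingFunction

open PowerSeries (rescale)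

/-- The invariant factor `∏_y (1 - r⟨x, y⟩)^(-κ)` of the generating function. -/
def invariantSeries (κ : ℝ) : PowerSeries Poly := ∏ k, oneSubPow (linForm (vertex k)) (-κ)

theorem genF_eq (κ : ℝ) (y : Fin 3 → ℝ) :
    genF κ y = oneSubSeries (linForm y) (-1) * invariantSeries κ := rfl

theorem map_reflect_invariantSeries (κ : ℝ) (k : Fin 15) :
    PowerSeries.map (reflect (posRoot k) : Poly →+* Poly) (invariantSeries κ) =
      invariantSeries κ := by
  simp only [invariantSeries, oneSubPow_eq, map_prod, map_oneSubSeries, reflect_linForm,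
    reflVec_vertex]
  exact (vertexPerm_bijective k).prod_comp fun l => oneSubSeries (linForm (vertex l)) (-κ)

theorem rescale_neg_one_invariantSeries (κ : ℝ) :
    rescale (-1) (invariantSeries κ) = invariantSeries κ := by
  simp only [invariantSeries, oneSubPow_eq, map_prod, rescale_neg_one_oneSubSeries, ← linForm_neg,
    ← vertex_antipode]
  exact antipode_bijective.prod_comp fun l => oneSubSeries (linForm (vertex l)) (-κ)

theorem map_reflect_genF (κ : ℝ) (k : Fin 15) (m : Fin 12) :
    PowerSeries.map (reflect (posRoot k) : Poly →+* Poly) (genF κ (vertex m)) =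
      genF κ (vertex (vertexPerm k m)) := by
  rw [genF_eq, genF_eq, map_mul, map_reflect_invariantSeries, map_oneSubSeries, reflect_linForm,
    reflVec_vertex]

theorem rescale_neg_one_genF (κ : ℝ) (y : Fin 3 → ℝ) :
    rescale (-1) (genF κ y) = oneSubSeries (-linForm y) (-1) * invariantSeries κ := by
  rw [genF_eq, map_mul, rescale_neg_one_invariantSeries, rescale_neg_one_oneSubSeries]

theorem genF_sub_genF (κ : ℝ) (y z : Fin 3 → ℝ) :
    genF κ y - genF κ z = PowerSeries.C (linForm (y - z)) *
      (PowerSeries.X * (invariantSeries κ * oneSubSeries (linForm y) (-1) *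
        oneSubSeries (linForm z) (-1))) := by
  have hy := one_sub_mul_oneSubSeries (linForm y)
  have hz := one_sub_mul_oneSubSeries (linForm z)
  rw [genF_eq, genF_eq, linForm_sub, map_sub]
  linear_combination (-invariantSeries κ * oneSubSeries (linForm y) (-1)) * hz +
    (invariantSeries κ * oneSubSeries (linForm z) (-1)) * hy

/-- The difference y - yσ is a multiple c v of the root, so ⟨x, v⟩ divides out of `genF_sub_genF`
and c vᵢ is again a coordinate of y - yσ. The result depends on the root only through the image
vertex, so it can be summed by `sum_vertexPerm`. -/
theorem C_mul_divDiff_q (κ : ℝ) (n : ℕ) (k : Fin 15) (m : Fin 12) (i : Fin 3) :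
    C (posRoot k i) * divDiff (posRoot k) (q κ n (vertex m)) =
      C (vertex m i - vertex (vertexPerm k m) i) *
        PowerSeries.coeff n (PowerSeries.X * (invariantSeries κ *
          oneSubSeries (linForm (vertex m)) (-1) *
          oneSubSeries (linForm (vertex (vertexPerm k m))) (-1))) := by
  set c : ℝ := 2 * (vertex m ⬝ᵥ posRoot k) / (posRoot k ⬝ᵥ posRoot k) with hc
  have hsub : vertex m - vertex (vertexPerm k m) = c • posRoot k := by
    rw [← reflVec_vertex, reflVec_eq, sub_sub_cancel]
  have hi : vertex m i - vertex (vertexPerm k m) i = c * posRoot k i := congrFun hsub i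
  rw [divDiff_eq_of_linForm_mul (posRoot_ne_zero k) (g := C c *
    PowerSeries.coeff n (PowerSeries.X * (invariantSeries κ *
          oneSubSeries (linForm (vertex m)) (-1) *
          oneSubSeries (linForm (vertex (vertexPerm k m))) (-1)))), hi, C_mul]
  · ring
  · have h := congrArg (PowerSeries.coeff n)
      (genF_sub_genF κ (vertex m) (vertex (vertexPerm k m)))
    rw [map_sub, ← map_reflect_genF, PowerSeries.coeff_map, PowerSeries.coeff_C_mul, hsub,
      linForm_smul] at h
    refine Eq.trans ?_ h.symm
    ring

theorem coeffDerivation_genF (κ : ℝ) (i : Fin 3) (y : Fin 3 → ℝ) :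
    coeffDerivation (pderiv i) (genF κ y) =
      PowerSeries.X * genF κ y * (algebraMap ℝ _ (y i) * oneSubSeries (linForm y) (-1) +
        algebraMap ℝ _ κ * ∑ k, algebraMap ℝ _ (vertex k i) *
          oneSubSeries (linForm (vertex k)) (-1)) := by
  have hG : coeffDerivation (pderiv i) (invariantSeries κ) = _ :=
    derivation_prod_of_eq_mul (coeffDerivation (pderiv i)) Finset.univ _ _ fun k _ =>
      coeffDerivation_oneSubSeries (pderiv i) (linForm (vertex k)) (-κ)
  rw [genF_eq, Derivation.leibniz, hG, coeffDerivation_oneSubSeries]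
  simp only [pderiv_linForm, smul_eq_mul, neg_smul, one_smul, neg_neg, ← Finset.smul_sum,
    mul_right_comm _ PowerSeries.X, ← Finset.sum_mul]
  rw [Algebra.smul_def]
  change oneSubSeries (linForm y) (-1) * (_ * invariantSeries κ) + _ = _
  simp only [IsScalarTower.algebraMap_apply ℝ Poly (PowerSeries Poly), algebraMap_eq,
    PowerSeries.algebraMap_apply, Algebra.algebraMap_self, RingHom.id_apply]
  ring

theorem derivative_genF (κ : ℝ) (y : Fin 3 → ℝ) :
    PowerSeries.derivative Poly (genF κ y) =
      genF κ y * (PowerSeries.C (linForm y) * oneSubSeries (linForm y) (-1) +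
        algebraMap ℝ _ κ * ∑ k, PowerSeries.C (linForm (vertex k)) *
          oneSubSeries (linForm (vertex k)) (-1)) := by
  have hG : PowerSeries.derivative Poly (invariantSeries κ) = _ :=
    derivation_prod_of_eq_mul (PowerSeries.derivative Poly) Finset.univ _ _ fun k _ =>
      derivative_oneSubSeries (linForm (vertex k)) (-κ)
  rw [genF_eq, Derivation.leibniz, hG, derivative_oneSubSeries]
  simp only [smul_eq_mul, neg_smul, one_smul, neg_neg, ← Finset.smul_sum]
  rw [Algebra.smul_def]
  change oneSubSeries (linForm y) (-1) * (_ * invariantSeries κ) + _ = _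
  ring

/-- The generating-function form of the lowering rule: the sums of yᵢ (1 - r⟨x, y⟩)⁻¹ from
differentiation and from the reflections cancel, and what remains is expressed through r ∂F/∂r, F(r)
and F(-r). -/
theorem dunkl_series_identity (κ : ℝ) (i : Fin 3) (m : Fin 12) :
    coeffDerivation (pderiv i) (genF κ (vertex m)) +
      algebraMap ℝ _ κ * ∑ k, algebraMap ℝ _ (vertex m i - vertex (vertexPerm k m) i) *
        (PowerSeries.X * (invariantSeries κ *
          oneSubSeries (linForm (vertex m)) (-1) *
          oneSubSeries (linForm (vertex (vertexPerm k m))) (-1))) =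
    algebraMap ℝ _ (vertex m i) * (PowerSeries.X * (genF κ (vertex m) +
      PowerSeries.X * PowerSeries.derivative Poly (genF κ (vertex m)) +
      11 * algebraMap ℝ _ κ * genF κ (vertex m) -
      algebraMap ℝ _ κ * rescale (-1) (genF κ (vertex m)))) := by
  have hU := one_sub_mul_oneSubSeries (linForm (vertex m))
  have hV := one_sub_mul_oneSubSeries (-linForm (vertex m))
  rw [map_neg] at hV
  -- The summand vanishes at the vertex itself, so the surplus copies drop out; the antipode
  -- contributes 2yᵢ(1 + r⟨x, y⟩)⁻¹.
  have hsum := sum_vertexPerm m fun l =>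
    algebraMap ℝ (PowerSeries Poly) (vertex m i - vertex l i) *
      oneSubSeries (linForm (vertex l)) (-1)
  rw [vertex_antipode, linForm_neg, Pi.neg_apply, sub_self, map_zero, zero_mul, smul_zero,
    add_zero] at hsum
  simp only [map_sub, map_neg, sub_mul (algebraMap ℝ (PowerSeries Poly) (vertex m i)),
    Finset.sum_sub_distrib, ← Finset.mul_sum] at hsum
  have hpull : ∑ k, algebraMap ℝ (PowerSeries Poly) (vertex m i - vertex (vertexPerm k m) i) *
        (PowerSeries.X * (invariantSeries κ *
          oneSubSeries (linForm (vertex m)) (-1) *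
          oneSubSeries (linForm (vertex (vertexPerm k m))) (-1))) =
      PowerSeries.X * (invariantSeries κ * oneSubSeries (linForm (vertex m)) (-1)) *
        (algebraMap ℝ (PowerSeries Poly) (vertex m i) *
          ∑ k, oneSubSeries (linForm (vertex (vertexPerm k m))) (-1) -
        ∑ k, algebraMap ℝ (PowerSeries Poly) (vertex (vertexPerm k m) i) *
          oneSubSeries (linForm (vertex (vertexPerm k m))) (-1)) := by
    rw [Finset.mul_sum, ← Finset.sum_sub_distrib, Finset.mul_sum]
    refine Finset.sum_congr rfl fun k _ => ?_
    rw [map_sub]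
    ring
  -- Each term is t/(1 - t) = 1/(1 - t) - 1, and there are twelve vertices.
  have hX : PowerSeries.X * ∑ k, PowerSeries.C (linForm (vertex k)) *
      oneSubSeries (linForm (vertex k)) (-1) =
      ∑ k, oneSubSeries (linForm (vertex k)) (-1) - 12 := by
    have h (k : Fin 12) : PowerSeries.X * (PowerSeries.C (linForm (vertex k)) *
        oneSubSeries (linForm (vertex k)) (-1)) =
        oneSubSeries (linForm (vertex k)) (-1) - 1 := by
      linear_combination -one_sub_mul_oneSubSeries (linForm (vertex k))
    rw [Finset.mul_sum, Finset.sum_congr rfl fun k _ => h k, Finset.sum_sub_distrib]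
    simp
  rw [hpull, coeffDerivation_genF, derivative_genF, rescale_neg_one_genF, genF_eq]
  generalize oneSubSeries (linForm (vertex m)) (-1) = U at *
  generalize oneSubSeries (-linForm (vertex m)) (-1) = V at *
  generalize algebraMap ℝ (PowerSeries Poly) κ = c at *
  generalize algebraMap ℝ (PowerSeries Poly) (vertex m i) = b at *
  generalize invariantSeries κ = G at *
  generalize PowerSeries.C (linForm (vertex m)) = a at *
  -- Partial fractions split the antipodal term -2κGUV into -κF(r) - κF(-r). The first part lowers
  -- 12κ to 11κ, and the second produces the sign (-1)ⁿ.
  have hUV : U + V = 2 * U * V := by linear_combination -V * hU - U * hV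
  linear_combination (c * PowerSeries.X * G * U) * hsum -
    (b * PowerSeries.X * G * U * c) * hX + (b * PowerSeries.X * G * U) * hU +
    (b * PowerSeries.X * G * c) * hUV

end GeneratingFunction

/-- The ratio `ν(n) / ν(n - 1) = n + 11κ + (-1)ⁿ κ`. -/
def dunklRatio (κ : ℝ) (n : ℕ) : ℝ := n + 11 * κ + (-1) ^ n * κ

theorem dunkl_q_succ (κ : ℝ) (i : Fin 3) (n : ℕ) (m : Fin 12) :
    dunkl κ i (q κ (n + 1) (vertex m)) =
      C (dunklRatio κ (n + 1) * vertex m i) * q κ n (vertex m) := by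
  have h := congrArg (PowerSeries.coeff (n + 1)) (dunkl_series_identity κ i m)
  have halg (c : ℝ) (f : PowerSeries Poly) (j : ℕ) :
      PowerSeries.coeff j (algebraMap ℝ _ c * f) = C c * PowerSeries.coeff j f := by
    rw [← Algebra.smul_def, PowerSeries.coeff_smul, smul_eq_C_mul]
  have hder : PowerSeries.coeff n (PowerSeries.X * PowerSeries.derivative Poly
      (genF κ (vertex m))) = C (n : ℝ) * q κ n (vertex m) := by
    cases n with
    | zero => simp
    | succ n =>
      rw [PowerSeries.coeff_succ_X_mul, PowerSeries.coeff_derivative, q]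
      push_cast
      rw [map_add, map_natCast, map_one]
      ring
  rw [map_add, coeff_coeffDerivation, halg, map_sum] at h
  simp only [halg, ← C_mul_divDiff_q] at h
  rw [PowerSeries.coeff_succ_X_mul, map_sub, map_add, map_add, hder, mul_assoc, halg,
    PowerSeries.coeff_rescale] at h
  have h11 : PowerSeries.coeff n (11 * (algebraMap ℝ (PowerSeries Poly) κ * genF κ (vertex m))) =
      C (11 * κ) * q κ n (vertex m) := by
    rw [← map_ofNat (algebraMap ℝ (PowerSeries Poly)) 11, halg, halg, map_mul, q]
    ring
  rw [h11] at h
  have hd : dunkl κ i (q κ (n + 1) (vertex m)) = pderiv i (q κ (n + 1) (vertex m)) +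
      C κ * ∑ k, C (posRoot k i) * divDiff (posRoot k) (q κ (n + 1) (vertex m)) := by
    simp only [dunkl, map_mul, mul_assoc, Finset.mul_sum]
  rw [hd]
  refine Eq.trans h ?_
  change C (vertex m i) * (q κ n (vertex m) + _ + _ - C κ * (_ * q κ n (vertex m))) = _
  rw [dunklRatio]
  push_cast
  simp only [map_mul, map_add, map_pow, map_neg, map_one]
  ring

theorem dunkl_q_zero (κ : ℝ) (i : Fin 3) (y : Fin 3 → ℝ) : dunkl κ i (q κ 0 y) = 0 := by
  have h := (totalDegree_zero_iff_isHomogeneous _).mpr (q_isHomogeneous κ 0 y)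
  rw [totalDegree_eq_zero_iff_eq_C.mp h, dunkl_C]

/-! ### The Dunkl Laplacian and the wavefunction polynomials -/

theorem poch_succ (a : ℝ) (n : ℕ) : poch a (n + 1) = poch a n * (a + n) := by
  simp [poch, ascPochhammer_succ_eval]

theorem poch_zero (a : ℝ) : poch a 0 = 1 := by
  simp [poch]

theorem poch_pos {a : ℝ} (ha : 0 < a) (n : ℕ) : 0 < poch a n :=
  ascPochhammer_pos n a ha

theorem ν_pos {κ : ℝ} (hκ : 0 ≤ κ) (n : ℕ) : 0 < ν κ n := by
  have h1 := poch_pos (show 0 < 6 * κ + 1 by positivity) (n / 2)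
  have h2 := poch_pos (show 0 < 5 * κ + 1 / 2 by positivity) ((n + 1) / 2)
  unfold ν
  positivity

theorem ν_zero (κ : ℝ) : ν κ 0 = 1 := by
  simp [ν, poch_zero]

theorem ν_succ (κ : ℝ) (n : ℕ) : ν κ (n + 1) = dunklRatio κ (n + 1) * ν κ n := by
  unfold ν dunklRatio
  rcases Nat.even_or_odd' n with ⟨m, rfl | rfl⟩
  · rw [show (2 * m + 1) / 2 = m by omega, show (2 * m + 1 + 1) / 2 = m + 1 by omega,
      show 2 * m / 2 = m by omega, poch_succ, Odd.neg_one_pow ⟨m, rfl⟩]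
    push_cast
    ring
  · rw [show (2 * m + 1 + 1) / 2 = m + 1 by omega, show (2 * m + 1 + 1 + 1) / 2 = m + 1 by omega,
      show (2 * m + 1) / 2 = m by omega, poch_succ, Even.neg_one_pow ⟨m + 1, by ring⟩]
    push_cast
    ring

theorem dunklLaplacian_C_mul (κ c : ℝ) (f : Poly) :
    dunklLaplacian κ (C c * f) = C c * dunklLaplacian κ f := by
  simp only [← dunklLaplacianLin_apply, ← smul_eq_C_mul, map_smul]

theorem dunklLaplacian_q_of_lt_two (κ : ℝ) {n : ℕ} (hn : n < 2) (m : Fin 12) :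
    dunklLaplacian κ (q κ n (vertex m)) = 0 := by
  have h0 (i : Fin 3) : dunkl κ i 0 = 0 := (dunklLin κ i).map_zero
  interval_cases n
  · simp [dunklLaplacian, dunkl_q_zero, h0]
  · simp only [dunklLaplacian, dunkl_q_succ, dunkl_C_mul, dunkl_q_zero, mul_zero,
      Finset.sum_const_zero]

theorem dunklLaplacian_q (κ : ℝ) (n : ℕ) (m : Fin 12) :
    dunklLaplacian κ (q κ (n + 2) (vertex m)) =
      C ((τ + 2) * (dunklRatio κ (n + 2) * dunklRatio κ (n + 1))) * q κ n (vertex m) := by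
  rw [dunklLaplacian, ← vertex_dot_self m, dotProduct, Finset.sum_mul, map_sum, Finset.sum_mul]
  refine Finset.sum_congr rfl fun i _ => ?_
  rw [dunkl_q_succ, dunkl_C_mul, dunkl_q_succ, ← mul_assoc, ← map_mul]
  congr 2
  ring

theorem dunklLaplacian_iterate_q {κ : ℝ} (hκ : 0 ≤ κ) (j n : ℕ) (m : Fin 12) :
    (dunklLaplacian κ)^[j] (q κ n (vertex m)) =
      if 2 * j ≤ n then C ((τ + 2) ^ j * (ν κ n / ν κ (n - 2 * j))) * q κ (n - 2 * j) (vertex m)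
      else 0 := by
  have hν (n : ℕ) := (ν_pos hκ n).ne'
  induction j with
  | zero => simp [hν]
  | succ j ih =>
    rw [Function.iterate_succ_apply', ih]
    by_cases h : 2 * (j + 1) ≤ n
    · obtain ⟨r, rfl⟩ := Nat.exists_eq_add_of_le h
      rw [if_pos (by omega), if_pos h, show 2 * (j + 1) + r - 2 * j = r + 2 by omega,
        show 2 * (j + 1) + r - 2 * (j + 1) = r by omega, dunklLaplacian_C_mul, dunklLaplacian_q,
        ← mul_assoc, ← map_mul]
      congr 2
      have h1 := ν_succ κ r
      have h2 := ν_succ κ (r + 1)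
      rw [h1] at h2
      have h3 := hν (r + 2)
      rw [h2] at h3 ⊢
      have h4 := hν r
      have h5 : dunklRatio κ (r + 2) ≠ 0 := left_ne_zero_of_mul h3
      have h6 : dunklRatio κ (r + 1) ≠ 0 := left_ne_zero_of_mul (right_ne_zero_of_mul h3)
      rw [show r + 1 + 1 = r + 2 from rfl]
      generalize τ + 2 = t
      field_simp
      ring
    · rw [if_neg h]
      split_ifs with h'
      · rw [dunklLaplacian_C_mul, dunklLaplacian_q_of_lt_two κ (by omega), mul_zero]
      · rw [← dunklLaplacianLin_apply, map_zero]

/-- The truncation point N is left free so that wₙ₊₁ and wₙ can be compared term by term. -/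
theorem w_eq_sum {κ : ℝ} (hκ : 0 ≤ κ) (ω : ℝ) {n N : ℕ} (hN : n < 2 * N) (m : Fin 12) :
    w κ ω n (vertex m) = ∑ j ∈ Finset.range N,
      C ((-1 / (4 * ω)) ^ j / (j.factorial : ℝ)) *
        (dunklLaplacian κ)^[j] (q κ n (vertex m)) := by
  refine finsum_eq_sum_of_support_subset _ fun j hj => ?_
  by_contra hj'
  simp only [Finset.coe_range, Set.mem_Iio, not_lt] at hj'
  rw [Function.mem_support, dunklLaplacian_iterate_q hκ, if_neg (by omega), mul_zero] at hj
  exact hj rfl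

theorem w_eq {κ : ℝ} (hκ : 0 ≤ κ) (ω : ℝ) (n : ℕ) (m : Fin 12) :
    w κ ω n (vertex m) = ∑ j ∈ Finset.range (n / 2 + 1),
      C ((-1) ^ j * ((τ + 2) ^ j / ((4 * ω) ^ j * (j.factorial : ℝ))) *
        (ν κ n / ν κ (n - 2 * j))) * q κ (n - 2 * j) (vertex m) := by
  rw [w_eq_sum hκ ω (N := n / 2 + 1) (by omega)]
  refine Finset.sum_congr rfl fun j hj => ?_
  have := Finset.mem_range.mp hj
  rw [dunklLaplacian_iterate_q hκ, if_pos (by omega), ← mul_assoc, ← map_mul]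
  congr 2
  rw [div_pow]
  ring

theorem constantCoeff_genF (κ : ℝ) (y : Fin 3 → ℝ) :
    PowerSeries.constantCoeff (genF κ y) = 1 := by
  have h (a : Poly) (s : ℝ) : PowerSeries.constantCoeff (oneSubSeries a s) = 1 := by
    rw [← PowerSeries.coeff_zero_eq_constantCoeff_apply, coeff_oneSubSeries]
    simp
  simp [genF, oneSubPow_eq, h]

theorem q_zero (κ : ℝ) (y : Fin 3 → ℝ) : q κ 0 y = 1 := by
  simp [q, constantCoeff_genF]

theorem w_zero {κ : ℝ} (hκ : 0 ≤ κ) (ω : ℝ) (m : Fin 12) : w κ ω 0 (vertex m) = 1 := by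
  rw [w_eq hκ]
  simp [q_zero, ν_zero]

/-- The explicit iterates show that 𝒟ᵢ commutes with powers of Δ_κ on the `q`; the general
commutativity of Dunkl operators is not needed. -/
theorem dunkl_iterate_q {κ : ℝ} (hκ : 0 ≤ κ) (i : Fin 3) (j n : ℕ) (m : Fin 12) :
    dunkl κ i ((dunklLaplacian κ)^[j] (q κ (n + 1) (vertex m))) =
      C (dunklRatio κ (n + 1) * vertex m i) * (dunklLaplacian κ)^[j] (q κ n (vertex m)) := by
  have hν (n : ℕ) := (ν_pos hκ n).ne'
  rw [dunklLaplacian_iterate_q hκ, dunklLaplacian_iterate_q hκ]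
  rcases lt_trichotomy (2 * j) (n + 1) with h | h | h
  · obtain ⟨r, rfl⟩ := Nat.exists_eq_add_of_le (Nat.le_of_lt_succ h)
    rw [if_pos (by omega), if_pos (by omega), show 2 * j + r + 1 - 2 * j = r + 1 by omega,
      show 2 * j + r - 2 * j = r by omega, dunkl_C_mul, dunkl_q_succ, ← mul_assoc, ← mul_assoc,
      ← map_mul, ← map_mul]
    congr 2
    have h3 := hν (r + 1)
    have h4 := hν r
    rw [ν_succ κ (2 * j + r)]
    rw [ν_succ κ r] at h3 ⊢
    have h5 := left_ne_zero_of_mul h3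
    field_simp
  · rw [if_pos (by omega), if_neg (by omega), dunkl_C_mul, show n + 1 - 2 * j = 0 by omega,
      dunkl_q_zero, mul_zero, mul_zero]
  · rw [if_neg (by omega), if_neg (by omega), mul_zero]
    exact (dunklLin κ i).map_zero

theorem dunkl_w_succ {κ : ℝ} (hκ : 0 ≤ κ) (ω : ℝ) (i : Fin 3) (n : ℕ) (m : Fin 12) :
    dunkl κ i (w κ ω (n + 1) (vertex m)) =
      C (dunklRatio κ (n + 1) * vertex m i) * w κ ω n (vertex m) := by
  rw [w_eq_sum hκ ω (N := n + 1) (by omega), w_eq_sum hκ ω (N := n + 1) (by omega),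
    Finset.mul_sum]
  refine (map_sum (dunklLin κ i) _ _).trans (Finset.sum_congr rfl fun j _ => ?_)
  refine (dunkl_C_mul κ i _ _).trans ?_
  rw [dunkl_iterate_q hκ]
  ring

/-! ### Functionals for which the Dunkl operators have the oscillator adjoint -/

theorem sum_X_mul_dunkl (κ : ℝ) {n : ℕ} {f : Poly} (hf : f.IsHomogeneous n) :
    ∑ i, X i * dunkl κ i f = C (n : ℝ) * f + ∑ k, C κ * (f - reflect (posRoot k) f) := by
  simp only [dunkl, mul_add, Finset.sum_add_distrib, Finset.mul_sum]
  rw [hf.sum_X_mul_pderiv, Finset.sum_comm]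
  congr 1
  · simp
  · refine Finset.sum_congr rfl fun k _ => ?_
    rw [← linForm_mul_divDiff, linForm, Finset.sum_mul, Finset.mul_sum]
    refine Finset.sum_congr rfl fun i _ => ?_
    rw [map_mul]
    ring

/-- A normalized linear functional, invariant under the reflections, for which the adjoint of
the Dunkl operator `𝒟ᵢ` is `2ω xᵢ - 𝒟ᵢ`. -/
structure OscillatorFunctional (κ ω : ℝ) where
  /-- The functional. -/
  toLin : Poly →ₗ[ℝ] ℝ
  map_one : toLin 1 = 1
  map_reflect : ∀ k f, toLin (reflect (posRoot k) f) = toLin f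
  adjoint : ∀ i f g, toLin (dunkl κ i f * g) + toLin (f * dunkl κ i g) =
    2 * ω * toLin (X i * f * g)

namespace OscillatorFunctional

variable {κ ω : ℝ} (I : OscillatorFunctional κ ω)

theorem map_C_mul (c : ℝ) (f : Poly) : I.toLin (C c * f) = c * I.toLin f := by
  rw [← smul_eq_C_mul, map_smul, smul_eq_mul]

/-- Pairing 𝒟ᵢf with 1 in the adjoint rule replaces the outer 𝒟ᵢ by 2ωxᵢ. Then ∑ xᵢ𝒟ᵢ is the Euler
operator plus terms f - fσ, which an invariant functional kills. -/
theorem degree_mul_map {n : ℕ} {f : Poly} (hf : f.IsHomogeneous n) :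
    2 * ω * (n * I.toLin f) = I.toLin (dunklLaplacian κ f) := by
  have h (i : Fin 3) : I.toLin (dunkl κ i (dunkl κ i f)) =
      2 * ω * I.toLin (X i * dunkl κ i f) := by
    have h := I.adjoint i (dunkl κ i f) 1
    rwa [← C_1, dunkl_C, mul_zero, map_zero, add_zero, C_1, mul_one, mul_one] at h
  rw [dunklLaplacian, map_sum, Finset.sum_congr rfl fun i _ => h i, ← Finset.mul_sum, ← map_sum,
    sum_X_mul_dunkl κ hf, map_add, map_sum, map_C_mul]
  simp only [map_C_mul, map_sub, map_reflect, sub_self, mul_zero, Finset.sum_const_zero, add_zero]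

theorem map_q_succ_succ (hω : 0 < ω) (n : ℕ) (m : Fin 12) :
    I.toLin (q κ (n + 2) (vertex m)) =
      (τ + 2) * (dunklRatio κ (n + 2) * dunklRatio κ (n + 1)) / (2 * ω * (n + 2)) *
        I.toLin (q κ n (vertex m)) := by
  have h := I.degree_mul_map (q_isHomogeneous κ (n + 2) (vertex m))
  rw [dunklLaplacian_q, map_C_mul] at h
  push_cast at h
  have h2 : (n : ℝ) + 2 ≠ 0 := by positivity
  generalize τ + 2 = t at *
  field_simp
  linarith

theorem map_q_even (hω : 0 < ω) (k : ℕ) (m : Fin 12) :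
    I.toLin (q κ (2 * k) (vertex m)) =
      (τ + 2) ^ k * ν κ (2 * k) / ((4 * ω) ^ k * (k.factorial : ℝ)) := by
  induction k with
  | zero =>
    simp [q_zero, I.map_one, ν_zero]
  | succ k ih =>
    rw [show 2 * (k + 1) = 2 * k + 2 by ring, map_q_succ_succ I hω, ih, ν_succ κ (2 * k + 1),
      ν_succ κ (2 * k), Nat.factorial_succ, show 2 * k + 1 + 1 = 2 * k + 2 from rfl]
    generalize τ + 2 = t
    push_cast
    have hk : (k : ℝ) + 1 ≠ 0 := by positivity
    have hf : (k.factorial : ℝ) ≠ 0 := by positivity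
    field_simp
    ring

theorem map_q_odd (hω : 0 < ω) (k : ℕ) (m : Fin 12) :
    I.toLin (q κ (2 * k + 1) (vertex m)) = 0 := by
  induction k with
  | zero =>
    have h := I.degree_mul_map (q_isHomogeneous κ 1 (vertex m))
    rw [dunklLaplacian_q_of_lt_two κ (by norm_num), map_zero] at h
    simpa [hω.ne'] using h
  | succ k ih =>
    rw [show 2 * (k + 1) + 1 = 2 * k + 1 + 2 by ring, map_q_succ_succ I hω, ih, mul_zero]

theorem map_w_of_pos (hκ : 0 ≤ κ) (hω : 0 < ω) {n : ℕ} (hn : 0 < n) (m : Fin 12) :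
    I.toLin (w κ ω n (vertex m)) = 0 := by
  have hν (n : ℕ) := (ν_pos hκ n).ne'
  rw [w_eq hκ, map_sum]
  simp only [map_C_mul]
  rcases Nat.even_or_odd' n with ⟨k, rfl | rfl⟩
  -- The moments of q turn the expansion of w₂ₖ into a constant times the alternating sum of
  -- binomial coefficients, which vanishes for k > 0.
  · have hterm : ∀ j ∈ Finset.range (2 * k / 2 + 1),
        (-1) ^ j * ((τ + 2) ^ j / ((4 * ω) ^ j * (j.factorial : ℝ))) *
          (ν κ (2 * k) / ν κ (2 * k - 2 * j)) * I.toLin (q κ (2 * k - 2 * j) (vertex m)) =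
        (τ + 2) ^ k * ν κ (2 * k) / ((4 * ω) ^ k * (k.factorial : ℝ)) *
          ((-1) ^ j * (k.choose j : ℝ)) := by
      intro j hj
      obtain ⟨r, rfl⟩ := Nat.exists_eq_add_of_le (show j ≤ k by have := Finset.mem_range.mp hj; omega)
      rw [show 2 * (j + r) - 2 * j = 2 * r by omega, map_q_even I hω,
        Nat.cast_add_choose]
      generalize τ + 2 = t
      have h1 := hν (2 * r)
      have h2 : ((j + r).factorial : ℝ) ≠ 0 := by positivity
      have h3 : (j.factorial : ℝ) ≠ 0 := by positivity
      have h4 : (r.factorial : ℝ) ≠ 0 := by positivity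
      field_simp
      ring
    rw [Finset.sum_congr rfl hterm, ← Finset.mul_sum, show 2 * k / 2 = k by omega]
    have h := Int.alternating_sum_range_choose_of_ne (show k ≠ 0 by omega)
    have h' : ∑ j ∈ Finset.range (k + 1), (-1 : ℝ) ^ j * (k.choose j : ℝ) = 0 := by
      exact_mod_cast h
    rw [h', mul_zero]
  · refine Finset.sum_eq_zero fun j hj => ?_
    obtain ⟨r, rfl⟩ := Nat.exists_eq_add_of_le (show j ≤ k by have := Finset.mem_range.mp hj; omega)
    rw [show 2 * (j + r) + 1 - 2 * j = 2 * r + 1 by omega, map_q_odd I hω, mul_zero]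

theorem map_X_mul_mul_w (hκ : 0 ≤ κ) (hω : 0 < ω) (i : Fin 3) (f : Poly) (n : ℕ) (m : Fin 12) :
    I.toLin (X i * f * w κ ω (n + 1) (vertex m)) =
      (2 * ω)⁻¹ * (I.toLin (dunkl κ i f * w κ ω (n + 1) (vertex m)) +
        dunklRatio κ (n + 1) * vertex m i * I.toLin (f * w κ ω n (vertex m))) := by
  have h := I.adjoint i f (w κ ω (n + 1) (vertex m))
  rw [dunkl_w_succ hκ, mul_left_comm, map_C_mul] at h
  rw [h, ← mul_assoc, inv_mul_cancel₀ (by positivity), one_mul]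

theorem monomial_eq_X_mul {s : Fin 3 →₀ ℕ} {d : ℕ} (hs : (s.sum fun _ e => e) = d + 1) (c : ℝ) :
    ∃ (i : Fin 3) (t : Fin 3 →₀ ℕ), (t.sum fun _ e => e) = d ∧
      monomial s c = X i * monomial t c := by
  obtain ⟨i, hi⟩ : ∃ i, s i ≠ 0 := by
    by_contra! h
    rw [show s = 0 from Finsupp.ext h] at hs
    simp at hs
  have h2 : Finsupp.single i 1 + (s - Finsupp.single i 1) = s :=
    add_tsub_cancel_of_le (Finsupp.single_le_iff.mpr (Nat.one_le_iff_ne_zero.mpr hi))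
  refine ⟨i, s - Finsupp.single i 1, ?_, ?_⟩
  · have h3 := congrArg (fun t : Fin 3 →₀ ℕ => t.sum fun _ e => e) h2
    simp only [Finsupp.sum_add_index' (h := fun _ e => e) (fun _ => rfl) (fun _ _ _ => rfl),
      Finsupp.sum_single_index] at h3
    omega
  · rw [X, monomial_mul, h2, one_mul]

/-- `wₙ` is orthogonal to all polynomials of lower degree. -/
theorem map_mul_w_of_totalDegree_lt (hκ : 0 ≤ κ) (hω : 0 < ω) (m : Fin 12) {d : ℕ} :
    ∀ (n : ℕ) (f : Poly), f.totalDegree ≤ d → d < n → I.toLin (f * w κ ω n (vertex m)) = 0 := by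
  induction d with
  | zero =>
    intro n f hf hn
    rw [totalDegree_eq_zero_iff_eq_C.mp (Nat.le_zero.mp hf), map_C_mul,
      map_w_of_pos I hκ hω hn, mul_zero]
  | succ d ih =>
    intro n f hf hn
    rw [f.as_sum, Finset.sum_mul, map_sum]
    refine Finset.sum_eq_zero fun s hs => ?_
    have hsd := (le_totalDegree hs).trans hf
    rcases Nat.lt_or_ge (s.sum fun _ e => e) (d + 1) with h | h
    · exact ih n _ ((totalDegree_monomial_le _ _).trans (Nat.le_of_lt_succ h)) (by omega)
    · obtain ⟨i, t, ht, he⟩ := monomial_eq_X_mul (le_antisymm hsd h) (f.coeff s)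
      obtain ⟨n, rfl⟩ := Nat.exists_eq_succ_of_ne_zero (show n ≠ 0 by omega)
      have htd : (monomial t (f.coeff s)).totalDegree ≤ d :=
        (totalDegree_monomial_le _ _).trans ht.le
      -- Removing one variable leaves a cofactor of degree at most d, paired with w of index one
      -- less; its Dunkl derivative also has degree at most d. Both terms fall under the induction
      -- hypothesis.
      rw [he, Nat.succ_eq_add_one, map_X_mul_mul_w I hκ hω,
        ih _ _ (totalDegree_dunkl_le κ i _ (htd.trans (Nat.le_succ d))) (by omega),
        ih _ _ htd (by omega)]
      simp

/-- `wₙ` reproduces the values of homogeneous polynomials of degree `n`. -/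
theorem map_mul_w_of_isHomogeneous (hκ : 0 ≤ κ) (hω : 0 < ω) (m : Fin 12) {n : ℕ} {f : Poly}
    (hf : f.IsHomogeneous n) :
    I.toLin (f * w κ ω n (vertex m)) = ((2 * ω) ^ n)⁻¹ * ν κ n * eval (vertex m) f := by
  have hmon (n : ℕ) : ∀ (s : Fin 3 →₀ ℕ) (c : ℝ), (s.sum fun _ e => e) = n →
      I.toLin (monomial s c * w κ ω n (vertex m)) =
        ((2 * ω) ^ n)⁻¹ * ν κ n * eval (vertex m) (monomial s c) := by
    induction n with
    | zero =>
      intro s c hs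
      have hs0 : s = 0 := by
        ext i
        by_contra hi
        have := Finset.sum_eq_zero_iff.mp hs i (Finsupp.mem_support_iff.mpr hi)
        exact hi this
      subst hs0
      rw [w_zero hκ, ← C_apply, map_C_mul, I.map_one, eval_C, ν_zero]
      simp
    | succ n ih =>
      intro s c hs
      obtain ⟨i, t, ht, he⟩ := monomial_eq_X_mul hs c
      have htd : (monomial t c).totalDegree ≤ n := (totalDegree_monomial_le _ _).trans ht.le
      -- The Dunkl derivative vanishes by orthogonality; the other term supplies one coordinate of
      -- the vertex and one factor ν(n+1)/ν(n).
      rw [he, map_X_mul_mul_w I hκ hω,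
        map_mul_w_of_totalDegree_lt I hκ hω m _ _
          (totalDegree_dunkl_le κ i _ (htd.trans (Nat.le_succ n))) (Nat.lt_succ_self n),
        ih t c ht, eval_mul, eval_X, ν_succ, pow_succ, mul_inv]
      ring
  rw [f.as_sum, Finset.sum_mul, map_sum, map_sum, Finset.mul_sum]
  refine Finset.sum_congr rfl fun s hs => hmon n s _ ?_
  have := hf (mem_support_iff.mp hs)
  have hw := DFunLike.congr_fun (Finsupp.degree_eq_weight_one (σ := Fin 3) (R := ℕ)) s
  rw [Finsupp.degree_apply] at hw
  exact hw.trans this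

/-- Only the leading term qₙ of one factor survives orthogonality to lower degrees, and the other
factor evaluates it at its own vertex. -/
theorem map_w_mul_w (hκ : 0 ≤ κ) (hω : 0 < ω) (n : ℕ) (l m : Fin 12) :
    I.toLin (w κ ω n (vertex l) * w κ ω n (vertex m)) =
      ((2 * ω) ^ n)⁻¹ * ν κ n * eval (vertex m) (q κ n (vertex l)) := by
  have hν := (ν_pos hκ n).ne'
  rw [w_eq hκ ω n l, Finset.sum_mul, map_sum, Finset.sum_range_succ', Finset.sum_eq_zero, zero_add]
  · rw [← map_mul_w_of_isHomogeneous I hκ hω m (q_isHomogeneous κ n (vertex l))]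
    simp [hν]
  · intro j hj
    have := Finset.mem_range.mp hj
    rw [mul_assoc, map_C_mul, map_mul_w_of_totalDegree_lt I hκ hω m n _
      (q_isHomogeneous κ _ (vertex l)).totalDegree_le (by omega), mul_zero]

end OscillatorFunctional

/-! ### Values of the polynomials `q` at the vertices -/

section Evaluation

open PowerSeries (expand)

/-- `(1 - aX)ˢ (1 + aX)ˢ = (1 - a²X²)ˢ`. -/
theorem oneSubSeries_mul_neg (a s : ℝ) :
    oneSubSeries a s * oneSubSeries (-a) s = expand 2 two_ne_zero (oneSubSeries (a ^ 2) s) := by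
  set E := expand (R := ℝ) 2 two_ne_zero with hE
  have hU := one_sub_mul_oneSubSeries a
  have hV := one_sub_mul_oneSubSeries (-a)
  have hW := congrArg E (one_sub_mul_oneSubSeries (a ^ 2))
  rw [map_neg] at hV
  rw [map_mul, map_sub, map_one, map_mul, hE, PowerSeries.expand_C, PowerSeries.expand_X, ← hE,
    map_pow] at hW
  have hder (f : PowerSeries ℝ) : PowerSeries.derivative ℝ (E f) =
      E (PowerSeries.derivative ℝ f) * (2 * PowerSeries.X) := by
    rw [hE, PowerSeries.expand_apply, PowerSeries.expand_apply,
      PowerSeries.derivative_subst (PowerSeries.HasSubst.X_pow two_ne_zero)]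
    simp
  have hcc (b t : ℝ) : PowerSeries.constantCoeff (oneSubSeries b t) = 1 := by
    rw [← PowerSeries.coeff_zero_eq_constantCoeff_apply, coeff_oneSubSeries]
    simp
  -- The quotient of the two sides has derivative zero and constant coefficient 1.
  have hquot : oneSubSeries a s * oneSubSeries (-a) s * E (oneSubSeries (a ^ 2) (-s)) = 1 := by
    refine PowerSeries.derivative.ext ?_ ?_
    · rw [Derivation.leibniz, Derivation.leibniz, hder, derivative_oneSubSeries,
        derivative_oneSubSeries, derivative_oneSubSeries, Derivation.map_one_eq_zero]
      simp only [smul_eq_mul, map_mul, map_neg, PowerSeries.smul_eq_C_mul, hE,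
        PowerSeries.expand_C, map_pow]
      rw [← hE]
      generalize oneSubSeries a s = P
      generalize oneSubSeries (-a) s = Q
      generalize E (oneSubSeries (a ^ 2) (-s)) = R
      generalize oneSubSeries a (-1) = U at *
      generalize oneSubSeries (-a) (-1) = V at *
      generalize E (oneSubSeries (a ^ 2) (-1)) = W at *
      generalize PowerSeries.C a = b at *
      have hUVW : U - V = 2 * b * PowerSeries.X * W := by
        linear_combination (V - U) * hW + (1 + b * PowerSeries.X) * W * hU -
          (1 - b * PowerSeries.X) * W * hV
      linear_combination (-(PowerSeries.C s) * b * P * Q * R) * hUVW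
    · simp [hE, hcc]
  calc oneSubSeries a s * oneSubSeries (-a) s
      = oneSubSeries a s * oneSubSeries (-a) s * (E (oneSubSeries (a ^ 2) (-s)) *
          E (oneSubSeries (a ^ 2) s)) := by
        rw [← map_mul, ← oneSubSeries_add, neg_add_cancel, oneSubSeries_zero, map_one, mul_one]
    _ = E (oneSubSeries (a ^ 2) s) := by rw [← mul_assoc, hquot, one_mul]

/-- Separates even and odd powers of r, so that both parities of n read off the same series in r².
-/
theorem oneSubSeries_neg_one_eq (a : ℝ) :
    oneSubSeries a (-1) = (1 + PowerSeries.C a * PowerSeries.X) *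
      expand 2 two_ne_zero (oneSubSeries (a ^ 2) (-1)) := by
  have hV := one_sub_mul_oneSubSeries (-a)
  rw [map_neg] at hV
  rw [← oneSubSeries_mul_neg]
  linear_combination (-oneSubSeries a (-1)) * hV

theorem oneSubSeries_pow (a s : ℝ) (n : ℕ) :
    oneSubSeries a s ^ n = oneSubSeries a (n * s) := by
  induction n with
  | zero => simp [oneSubSeries_zero]
  | succ n ih =>
    rw [pow_succ, ih, ← oneSubSeries_add]
    push_cast
    ring_nf

theorem map_eval_genF (κ : ℝ) (m : Fin 12) (y : Fin 3 → ℝ) :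
    PowerSeries.map (eval (vertex m)) (genF κ y) =
      oneSubSeries (vertex m ⬝ᵥ y) (-1) * expand 2 two_ne_zero
        (oneSubSeries ((τ + 2) ^ 2) (-κ) * oneSubSeries (τ ^ 2) (-(5 * κ))) := by
  have h (v : Fin 3 → ℝ) (s : ℝ) : PowerSeries.map (eval (vertex m)) (oneSubSeries (linForm v) s) =
      oneSubSeries (vertex m ⬝ᵥ v) s := by
    rw [← eval_linForm]
    exact map_oneSubSeries (aeval (vertex m) : Poly →ₐ[ℝ] ℝ) (linForm v) s
  simp only [genF_eq, invariantSeries, oneSubPow_eq, map_mul, map_prod, h]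
  rw [prod_vertex_dot m fun a => oneSubSeries a (-κ), oneSubSeries_mul_neg, oneSubSeries_mul_neg,
    ← map_pow, oneSubSeries_pow]
  norm_num

theorem coeff_one_add_mul_expand_even (a : ℝ) (f : PowerSeries ℝ) (n : ℕ) :
    PowerSeries.coeff (2 * n) ((1 + PowerSeries.C a * PowerSeries.X) *
      expand 2 two_ne_zero f) = PowerSeries.coeff n f := by
  rw [add_mul, one_mul, map_add, PowerSeries.coeff_expand_mul, mul_assoc, PowerSeries.coeff_C_mul]
  cases n with
  | zero => simp
  | succ n =>
    rw [show 2 * (n + 1) = 2 * n + 1 + 1 by ring, PowerSeries.coeff_succ_X_mul,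
      PowerSeries.coeff_expand_of_not_dvd 2 two_ne_zero _ (by omega), mul_zero, add_zero]

theorem coeff_one_add_mul_expand_odd (a : ℝ) (f : PowerSeries ℝ) (n : ℕ) :
    PowerSeries.coeff (2 * n + 1) ((1 + PowerSeries.C a * PowerSeries.X) *
      expand 2 two_ne_zero f) = a * PowerSeries.coeff n f := by
  rw [add_mul, one_mul, map_add, mul_assoc, PowerSeries.coeff_C_mul, PowerSeries.coeff_succ_X_mul,
    PowerSeries.coeff_expand_mul, PowerSeries.coeff_expand_of_not_dvd 2 two_ne_zero _ (by omega),
    zero_add]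

theorem coeff_oneSubSeries_neg (a s : ℝ) (n : ℕ) :
    PowerSeries.coeff n (oneSubSeries a (-s)) = poch s n / (n.factorial : ℝ) * a ^ n := by
  have h (n : ℕ) : Ring.choose (-s) n = (-1) ^ n * (poch s n / (n.factorial : ℝ)) := by
    induction n with
    | zero => simp [poch_zero]
    | succ n ih =>
      have h1 := Ring.choose_smul_choose (-s) (Nat.le_succ n)
      rw [Nat.choose_succ_self_right, Nat.succ_sub (le_refl n), Nat.sub_self,
        Ring.choose_one_right, ih, nsmul_eq_mul] at h1
      have h2 : ((n : ℝ) + 1) ≠ 0 := by positivity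
      have h3 : (n.factorial : ℝ) ≠ 0 := by positivity
      rw [poch_succ, Nat.factorial_succ]
      push_cast at h1 ⊢
      apply mul_left_cancel₀ h2
      rw [h1]
      field_simp
      ring
  have h1 : ((-1 : ℝ) ^ n) ^ 2 = 1 := by rw [← pow_mul, mul_comm, pow_mul]; simp
  rw [coeff_oneSubSeries, h, neg_pow a, smul_eq_mul]
  linear_combination (poch s n / (n.factorial : ℝ) * a ^ n) * h1

/-- This is the source of the powers of 5 in Y⁽⁰⁾ and Y⁽¹⁾. -/
theorem τ_add_two_sq : (τ + 2) ^ 2 = 5 * τ ^ 2 := by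
  have := Real.goldenRatio_sq
  linear_combination (-4) * this

theorem coeff_oneSubSeries_mul (b s t : ℝ) (n : ℕ) :
    PowerSeries.coeff n (oneSubSeries (5 * b) (-s) * oneSubSeries b (-t)) =
      b ^ n * ∑ j ∈ Finset.range (n + 1),
        poch s j * poch t (n - j) / ((j.factorial : ℝ) * ((n - j).factorial : ℝ)) * 5 ^ j := by
  rw [PowerSeries.coeff_mul, Finset.Nat.sum_antidiagonal_eq_sum_range_succ_mk, Finset.mul_sum]
  refine Finset.sum_congr rfl fun j hj => ?_
  obtain ⟨r, rfl⟩ := Nat.exists_eq_add_of_le (Nat.le_of_lt_succ (Finset.mem_range.mp hj))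
  simp only [coeff_oneSubSeries_neg, Nat.add_sub_cancel_left]
  rw [mul_pow, pow_add]
  ring

/-- The factor (1 - r⟨x, y₀⟩)⁻¹ raises the exponent κ attached to (τ + 2)² to κ + 1; for a
neighbouring vertex it raises the exponent 5κ attached to τ² instead. -/
theorem map_eval_genF_self (κ : ℝ) (m : Fin 12) :
    PowerSeries.map (eval (vertex m)) (genF κ (vertex m)) =
      (1 + PowerSeries.C (τ + 2) * PowerSeries.X) * expand 2 two_ne_zero
        (oneSubSeries (5 * τ ^ 2) (-(κ + 1)) * oneSubSeries (τ ^ 2) (-(5 * κ))) := by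
  rw [map_eval_genF, vertex_dot_self, oneSubSeries_neg_one_eq, mul_assoc, ← map_mul, ← mul_assoc,
    ← oneSubSeries_add, τ_add_two_sq, neg_add_rev]

theorem map_eval_genF_neighbor (κ : ℝ) (m l : Fin 12) (h : vertex m ⬝ᵥ vertex l = τ) :
    PowerSeries.map (eval (vertex m)) (genF κ (vertex l)) =
      (1 + PowerSeries.C τ * PowerSeries.X) * expand 2 two_ne_zero
        (oneSubSeries (5 * τ ^ 2) (-κ) * oneSubSeries (τ ^ 2) (-(5 * κ + 1))) := by
  rw [map_eval_genF, h, oneSubSeries_neg_one_eq, mul_assoc, ← map_mul, mul_left_comm,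
    ← oneSubSeries_add, τ_add_two_sq, neg_add_rev]

theorem eval_q (κ : ℝ) (n : ℕ) (m : Fin 12) (y : Fin 3 → ℝ) :
    eval (vertex m) (q κ n y) =
      PowerSeries.coeff n (PowerSeries.map (eval (vertex m)) (genF κ y)) := by
  rw [PowerSeries.coeff_map, q]

theorem eval_q_even_self (κ : ℝ) (n : ℕ) (m : Fin 12) :
    eval (vertex m) (q κ (2 * n) (vertex m)) = τ ^ (2 * n) * Y0 κ n := by
  rw [eval_q, map_eval_genF_self, coeff_one_add_mul_expand_even, coeff_oneSubSeries_mul, ← pow_mul,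
    Y0]

theorem eval_q_odd_self (κ : ℝ) (n : ℕ) (m : Fin 12) :
    eval (vertex m) (q κ (2 * n + 1) (vertex m)) = (τ + 2) * τ ^ (2 * n) * Y0 κ n := by
  rw [eval_q, map_eval_genF_self, coeff_one_add_mul_expand_odd, coeff_oneSubSeries_mul, ← pow_mul,
    Y0, mul_assoc]

theorem eval_q_even_neighbor (κ : ℝ) (n : ℕ) (m l : Fin 12) (h : vertex m ⬝ᵥ vertex l = τ) :
    eval (vertex m) (q κ (2 * n) (vertex l)) = τ ^ (2 * n) * Y1 κ n := by
  rw [eval_q, map_eval_genF_neighbor κ m l h, coeff_one_add_mul_expand_even,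
    coeff_oneSubSeries_mul, ← pow_mul, Y1]

theorem eval_q_odd_neighbor (κ : ℝ) (n : ℕ) (m l : Fin 12) (h : vertex m ⬝ᵥ vertex l = τ) :
    eval (vertex m) (q κ (2 * n + 1) (vertex l)) = τ ^ (2 * n + 1) * Y1 κ n := by
  rw [eval_q, map_eval_genF_neighbor κ m l h, coeff_one_add_mul_expand_odd,
    coeff_oneSubSeries_mul, ← pow_mul, Y1]
  ring

end Evaluation

/-! ### Regularized weights and integration by parts -/

section Analysis

open MeasureTheory Filter Topology

/-- The weight `exp(-ω|x|²) ∏_v (⟨x, v⟩² + ε)^κ`, smooth for `ε > 0`. -/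
def regWeight (κ ω ε : ℝ) (x : Fin 3 → ℝ) : ℝ :=
  Real.exp (-ω * (x ⬝ᵥ x)) * ∏ k, ((x ⬝ᵥ posRoot k) ^ 2 + ε) ^ κ

theorem regWeight_zero (κ ω : ℝ) (x : Fin 3 → ℝ) :
    regWeight κ ω 0 x = Real.exp (-ω * (x ⬝ᵥ x)) * hWeight κ x ^ 2 := by
  rw [regWeight, hWeight, ← Finset.prod_pow]
  congr 1
  refine Finset.prod_congr rfl fun k _ => ?_
  rw [add_zero, ← sq_abs, ← Real.rpow_natCast, ← Real.rpow_natCast, ← Real.rpow_mul (abs_nonneg _),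
    ← Real.rpow_mul (abs_nonneg _), mul_comm]

theorem regWeight_eq_exp (κ ω : ℝ) {ε : ℝ} (hε : 0 < ε) (x : Fin 3 → ℝ) :
    regWeight κ ω ε x =
      Real.exp (-ω * (x ⬝ᵥ x) + ∑ k, Real.log ((x ⬝ᵥ posRoot k) ^ 2 + ε) * κ) := by
  rw [Real.exp_add, Real.exp_sum, regWeight]
  congr 1
  exact Finset.prod_congr rfl fun k _ => Real.rpow_def_of_pos (by positivity) _

theorem regWeight_nonneg (κ ω : ℝ) {ε : ℝ} (hε : 0 ≤ ε) (x : Fin 3 → ℝ) :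
    0 ≤ regWeight κ ω ε x := by
  unfold regWeight
  exact mul_nonneg (Real.exp_nonneg _)
    (Finset.prod_nonneg fun k _ => Real.rpow_nonneg (by positivity) _)

theorem continuous_dot (v : Fin 3 → ℝ) : Continuous fun x : Fin 3 → ℝ => x ⬝ᵥ v := by
  unfold dotProduct
  fun_prop

theorem continuous_dot_self : Continuous fun x : Fin 3 → ℝ => x ⬝ᵥ x := by
  unfold dotProduct
  fun_prop

theorem continuous_eval_poly (f : Poly) : Continuous fun x : Fin 3 → ℝ => eval x f :=
  MvPolynomial.continuous_eval f

theorem continuous_regWeight {κ : ℝ} (hκ : 0 ≤ κ) (ω ε : ℝ) : Continuous (regWeight κ ω ε) := by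
  unfold regWeight
  refine (Real.continuous_exp.comp (continuous_dot_self.const_mul _)).mul
    (continuous_finsetProd _ fun k _ => ?_)
  exact (Real.continuous_rpow_const hκ).comp (((continuous_dot _).pow 2).add_const ε)

/-- Reflections permute the roots up to sign, and only squares of the linear forms occur. -/
theorem regWeight_reflVec (κ ω ε : ℝ) (k : Fin 15) (x : Fin 3 → ℝ) :
    regWeight κ ω ε (reflVec (posRoot k) x) = regWeight κ ω ε x := by
  have h0 : posRoot k ⬝ᵥ posRoot k ≠ 0 := by rw [posRoot_dot_self]; norm_num
  unfold regWeight
  rw [reflVec_dot, reflVec_reflVec h0,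
    ← (rootPerm_bijective k).prod_comp fun m => ((x ⬝ᵥ posRoot m) ^ 2 + ε) ^ κ]
  congr 1
  refine Finset.prod_congr rfl fun m _ => ?_
  rw [reflVec_dot]
  rcases reflVec_posRoot k m with h | h <;> rw [h]
  rw [dotProduct_neg, neg_sq]

/-- The polynomial `∏_v (⟨x, v⟩² + 1)^N`, which bounds the regularized weights. -/
def weightBound (N : ℕ) : Poly := ∏ k, (linForm (posRoot k) ^ 2 + 1) ^ N

theorem regWeight_le {κ : ℝ} (hκ : 0 ≤ κ) (ω : ℝ) {ε : ℝ} (hε : 0 ≤ ε) (hε1 : ε ≤ 1)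
    (x : Fin 3 → ℝ) :
    regWeight κ ω ε x ≤ eval x (weightBound ⌈κ⌉₊) * Real.exp (-ω * (x ⬝ᵥ x)) := by
  rw [regWeight, mul_comm, weightBound, map_prod]
  refine mul_le_mul_of_nonneg_right ?_ (Real.exp_nonneg _)
  refine Finset.prod_le_prod (fun k _ => Real.rpow_nonneg (by positivity) _) fun k _ => ?_
  simp only [map_pow, map_add, map_one, eval_linForm]
  calc ((x ⬝ᵥ posRoot k) ^ 2 + ε) ^ κ ≤ ((x ⬝ᵥ posRoot k) ^ 2 + 1) ^ κ :=
        Real.rpow_le_rpow (by positivity) (by linarith) hκ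
    _ ≤ ((x ⬝ᵥ posRoot k) ^ 2 + 1) ^ (⌈κ⌉₊ : ℝ) :=
        Real.rpow_le_rpow_of_exponent_le (by nlinarith [sq_nonneg (x ⬝ᵥ posRoot k)]) (Nat.le_ceil κ)
    _ = _ := Real.rpow_natCast _ _

theorem integrable_eval_mul_gaussian {ω : ℝ} (hω : 0 < ω) (f : Poly) :
    Integrable fun x : Fin 3 → ℝ => eval x f * Real.exp (-ω * (x ⬝ᵥ x)) := by
  induction f using MvPolynomial.induction_on' with
  | monomial s c =>
    have h1 (n : ℕ) : Integrable fun t : ℝ => t ^ n * Real.exp (-ω * t ^ 2) := by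
      have h := integrable_rpow_mul_exp_neg_mul_sq hω (s := n)
        (by linarith [Nat.cast_nonneg (α := ℝ) n])
      simpa only [Real.rpow_natCast] using h
    have h2 := (Integrable.fintype_prod (f := fun (i : Fin 3) (t : ℝ) =>
      t ^ s i * Real.exp (-ω * t ^ 2)) (fun i => h1 (s i))).const_mul c
    refine h2.congr (Eventually.of_forall fun x => ?_)
    simp only [eval_monomial, Finset.prod_mul_distrib, ← Real.exp_sum, ← Finset.mul_sum,
      dotProduct, ← sq, mul_assoc]
    rw [Finsupp.prod_fintype _ _ fun i => pow_zero _]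
  | add p q hp hq =>
    simp only [map_add, add_mul]
    exact hp.add hq

/-- The bounded factor c accommodates the regularizers (⟨x, v⟩² + ε)⁻¹, which are not polynomial. -/
theorem integrable_eval_mul_regWeight {κ ω : ℝ} (hκ : 0 ≤ κ) (hω : 0 < ω) {ε : ℝ} (hε : 0 ≤ ε)
    (hε1 : ε ≤ 1) (f : Poly) {c : (Fin 3 → ℝ) → ℝ} (hc : Measurable c) {K : ℝ}
    (hK : ∀ x, |c x| ≤ K) :
    Integrable fun x : Fin 3 → ℝ => eval x f * c x * regWeight κ ω ε x := by
  have hb := ((integrable_eval_mul_gaussian hω (f * weightBound ⌈κ⌉₊)).norm).const_mul K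
  refine hb.mono' ?_ (Eventually.of_forall fun x => ?_)
  · exact (((continuous_eval_poly f).measurable.mul hc).mul
      (continuous_regWeight hκ ω ε).measurable).aestronglyMeasurable
  · rw [norm_mul, norm_mul, norm_mul, map_mul, norm_mul, Real.norm_of_nonneg (Real.exp_nonneg _),
      Real.norm_of_nonneg (regWeight_nonneg κ ω hε x), Real.norm_eq_abs (c x)]
    have hK0 : 0 ≤ K := (abs_nonneg _).trans (hK x)
    have h1 : regWeight κ ω ε x ≤
        ‖eval x (weightBound ⌈κ⌉₊)‖ * Real.exp (-ω * (x ⬝ᵥ x)) :=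
      (regWeight_le hκ ω hε hε1 x).trans
        (mul_le_mul_of_nonneg_right (Real.le_norm_self _) (Real.exp_nonneg _))
    calc ‖eval x f‖ * |c x| * regWeight κ ω ε x
        ≤ ‖eval x f‖ * K * (‖eval x (weightBound ⌈κ⌉₊)‖ * Real.exp (-ω * (x ⬝ᵥ x))) := by
          gcongr
          · exact regWeight_nonneg κ ω hε x
          · exact hK x
      _ = _ := by ring

theorem integrable_eval_mul_regWeight' {κ ω : ℝ} (hκ : 0 ≤ κ) (hω : 0 < ω) {ε : ℝ} (hε : 0 ≤ ε)
    (hε1 : ε ≤ 1) (f : Poly) :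
    Integrable fun x : Fin 3 → ℝ => eval x f * regWeight κ ω ε x := by
  have h := integrable_eval_mul_regWeight hκ hω hε hε1 f (c := fun _ => 1) measurable_const
    (K := 1) (by simp)
  simpa using h

theorem hasLineDerivAt_eval (f : Poly) (i : Fin 3) (x : Fin 3 → ℝ) :
    HasLineDerivAt ℝ (fun x => eval x f) (eval x (pderiv i f)) x (Pi.single i 1) := by
  unfold HasLineDerivAt
  induction f using MvPolynomial.induction_on with
  | C a => simpa using hasDerivAt_const (0 : ℝ) a
  | add p q hp hq => simpa using hp.fun_add hq
  | mul_X p j hp =>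
    have hX : HasDerivAt (fun t : ℝ => eval (x + t • (Pi.single i 1 : Fin 3 → ℝ)) (X j : Poly))
        (eval x (pderiv i (X j : Poly))) 0 := by
      simp only [eval_X, Pi.add_apply, Pi.smul_apply, smul_eq_mul]
      have h := ((hasDerivAt_id (0 : ℝ)).mul_const ((Pi.single i 1 : Fin 3 → ℝ) j)).const_add (x j)
      rcases eq_or_ne j i with rfl | hji
      · simpa using h
      · simpa [pderiv_X, Pi.single_apply, hji, hji.symm] using h
    have h := hp.fun_mul hX
    simp only [zero_smul, add_zero] at h
    simp only [Derivation.leibniz, smul_eq_mul, map_add, map_mul]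
    exact h.congr_deriv (by ring)

theorem hasLineDerivAt_regWeight (κ ω : ℝ) {ε : ℝ} (hε : 0 < ε) (i : Fin 3) (x : Fin 3 → ℝ) :
    HasLineDerivAt ℝ (regWeight κ ω ε)
      ((-(2 * ω * x i) + ∑ k, 2 * κ * posRoot k i *
        ((x ⬝ᵥ posRoot k) * ((x ⬝ᵥ posRoot k) ^ 2 + ε)⁻¹)) * regWeight κ ω ε x)
      x (Pi.single i 1) := by
  unfold HasLineDerivAt
  simp only [regWeight_eq_exp κ ω hε]
  have hlin (v : Fin 3 → ℝ) : HasDerivAt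
      (fun t : ℝ => (x + t • (Pi.single i 1 : Fin 3 → ℝ)) ⬝ᵥ v) (v i) 0 := by
    have h := ((hasDerivAt_id (0 : ℝ)).mul_const (v i)).const_add (x ⬝ᵥ v)
    simpa [add_dotProduct, smul_dotProduct] using h
  have hsq : HasDerivAt (fun t : ℝ => (x + t • (Pi.single i 1 : Fin 3 → ℝ)) ⬝ᵥ
      (x + t • (Pi.single i 1 : Fin 3 → ℝ))) (2 * x i) 0 := by
    have hfun : (fun t : ℝ => (x + t • (Pi.single i 1 : Fin 3 → ℝ)) ⬝ᵥ
        (x + t • (Pi.single i 1 : Fin 3 → ℝ))) = fun t => x ⬝ᵥ x + t * (2 * x i) + t ^ 2 := by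
      funext t
      simp [add_dotProduct, dotProduct_add, smul_dotProduct, dotProduct_smul]
      ring
    rw [hfun]
    have h := (((hasDerivAt_id' (0 : ℝ)).mul_const (2 * x i)).const_add (x ⬝ᵥ x)).fun_add
      ((hasDerivAt_id' (0 : ℝ)).fun_pow 2)
    exact h.congr_deriv (by simp)
  have hlog (k : Fin 15) : HasDerivAt (fun t : ℝ => Real.log
      (((x + t • (Pi.single i 1 : Fin 3 → ℝ)) ⬝ᵥ posRoot k) ^ 2 + ε) * κ)
      (2 * κ * posRoot k i * ((x ⬝ᵥ posRoot k) * ((x ⬝ᵥ posRoot k) ^ 2 + ε)⁻¹)) 0 := by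
    have h := ((((hlin (posRoot k)).fun_pow 2).add_const ε).log (by positivity)).mul_const κ
    refine h.congr_deriv ?_
    simp only [zero_smul, add_zero]
    push_cast
    ring
  have h := ((hsq.const_mul (-ω)).fun_add (HasDerivAt.fun_sum fun k (_ : k ∈ Finset.univ) =>
    hlog k)).exp
  refine h.congr_deriv ?_
  simp only [zero_smul, add_zero]
  ring

theorem measurable_regularizer (v : Fin 3 → ℝ) (ε : ℝ) :
    Measurable fun x : Fin 3 → ℝ => ((x ⬝ᵥ v) ^ 2 + ε)⁻¹ :=
  (((continuous_dot v).pow 2).add_const ε).measurable.inv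

theorem abs_regularizer_le (v : Fin 3 → ℝ) {ε : ℝ} (hε : 0 < ε) (x : Fin 3 → ℝ) :
    |((x ⬝ᵥ v) ^ 2 + ε)⁻¹| ≤ ε⁻¹ := by
  rw [abs_of_nonneg (by positivity)]
  exact inv_anti₀ hε (by nlinarith [sq_nonneg (x ⬝ᵥ v)])

theorem integral_pderiv_regWeight {κ ω : ℝ} (hκ : 0 ≤ κ) (hω : 0 < ω) {ε : ℝ} (hε : 0 < ε)
    (hε1 : ε ≤ 1) (i : Fin 3) (u : Poly) :
    (∫ x : Fin 3 → ℝ, eval x (pderiv i u - C (2 * ω) * X i * u) * regWeight κ ω ε x) +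
      ∑ k, ∫ x : Fin 3 → ℝ, eval x (C (2 * κ * posRoot k i) * (linForm (posRoot k) * u)) *
        ((x ⬝ᵥ posRoot k) ^ 2 + ε)⁻¹ * regWeight κ ω ε x = 0 := by
  have hint (k : Fin 15) := integrable_eval_mul_regWeight hκ hω hε.le hε1
    (C (2 * κ * posRoot k i) * (linForm (posRoot k) * u)) (measurable_regularizer (posRoot k) ε)
    (abs_regularizer_le (posRoot k) hε)
  have hsum := integrable_finsetSum Finset.univ fun k _ => hint k
  have hI1 := integrable_eval_mul_regWeight' hκ hω hε.le hε1 (pderiv i u)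
  have hI2 := integrable_eval_mul_regWeight' hκ hω hε.le hε1 (C (2 * ω) * X i * u)
  have hI3 := integrable_eval_mul_regWeight' hκ hω hε.le hε1 u
  have heq (x : Fin 3 → ℝ) : eval x u * ((-(2 * ω * x i) + ∑ k, 2 * κ * posRoot k i *
        ((x ⬝ᵥ posRoot k) * ((x ⬝ᵥ posRoot k) ^ 2 + ε)⁻¹)) * regWeight κ ω ε x) =
      -(eval x (C (2 * ω) * X i * u) * regWeight κ ω ε x) +
      ∑ k, eval x (C (2 * κ * posRoot k i) * (linForm (posRoot k) * u)) *
        ((x ⬝ᵥ posRoot k) ^ 2 + ε)⁻¹ * regWeight κ ω ε x := by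
    simp only [map_mul, eval_C, eval_X, eval_linForm, ← Finset.sum_mul]
    have h : ∑ k, 2 * κ * posRoot k i * (x ⬝ᵥ posRoot k * eval x u) *
        ((x ⬝ᵥ posRoot k) ^ 2 + ε)⁻¹ = eval x u * ∑ k, 2 * κ * posRoot k i *
        ((x ⬝ᵥ posRoot k) * ((x ⬝ᵥ posRoot k) ^ 2 + ε)⁻¹) := by
      rw [Finset.mul_sum]
      exact Finset.sum_congr rfl fun k _ => by ring
    rw [h]
    ring
  have hparts := integral_bilinear_hasLineDerivAt_right_eq_neg_left_of_integrable
    (μ := (volume : Measure (Fin 3 → ℝ))) (B := ContinuousLinearMap.mul ℝ ℝ)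
    (f := fun x => eval x u) (f' := fun x => eval x (pderiv i u)) (g := regWeight κ ω ε)
    (g' := fun x => (-(2 * ω * x i) + ∑ k, 2 * κ * posRoot k i *
        ((x ⬝ᵥ posRoot k) * ((x ⬝ᵥ posRoot k) ^ 2 + ε)⁻¹)) * regWeight κ ω ε x)
    (v := Pi.single i 1) hI1
    (by
      simp only [ContinuousLinearMap.mul_apply', heq]
      exact hI2.neg.add hsum)
    hI3 (fun x _ => hasLineDerivAt_eval u i x) (fun x _ => hasLineDerivAt_regWeight κ ω hε i x)
  simp only [ContinuousLinearMap.mul_apply', heq] at hparts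
  rw [integral_add (f := fun x => -(eval x (C (2 * ω) * X i * u) * regWeight κ ω ε x)) hI2.neg hsum,
    integral_neg, integral_finsetSum _ fun k _ => hint k] at hparts
  simp only [map_sub, sub_mul] at hI2 ⊢
  rw [integral_sub hI1 hI2]
  linarith

/-- The reflection along `v` as a linear map. -/
def reflLin (v : Fin 3 → ℝ) : (Fin 3 → ℝ) →ₗ[ℝ] (Fin 3 → ℝ) where
  toFun := reflVec v
  map_add' x y := by
    funext i
    simp only [reflVec, add_dotProduct, Pi.add_apply]
    ring
  map_smul' c x := by
    funext i
    simp only [reflVec, smul_dotProduct, Pi.smul_apply, smul_eq_mul, RingHom.id_apply]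
    ring

/-- A linear involution has determinant ±1 and so preserves volume. -/
theorem integral_comp_reflVec {v : Fin 3 → ℝ} (hv : v ⬝ᵥ v ≠ 0) (F : (Fin 3 → ℝ) → ℝ) :
    ∫ x, F (reflVec v x) = ∫ x, F x := by
  have hinv : reflLin v ∘ₗ reflLin v = LinearMap.id := LinearMap.ext fun x => reflVec_reflVec hv x
  have hdet : LinearMap.det (reflLin v) * LinearMap.det (reflLin v) = 1 := by
    rw [← LinearMap.det_comp, hinv, LinearMap.det_id]
  have habs : |(LinearMap.det (reflLin v))⁻¹| = 1 := by
    rcases mul_self_eq_one_iff.mp hdet with h | h <;> simp [h]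
  have hcont : Continuous (reflVec v) := LinearMap.continuous_of_finiteDimensional (reflLin v)
  have hmap := Real.map_linearMap_volume_pi_eq_smul_volume_pi (left_ne_zero_of_mul_eq_one hdet)
  rw [habs, ENNReal.ofReal_one, one_smul] at hmap
  have hemb : MeasurableEmbedding (reflVec v) := by
    exact (MeasurableEquiv.mk ⟨reflVec v, reflVec v, reflVec_reflVec hv, reflVec_reflVec hv⟩
      hcont.measurable hcont.measurable).measurableEmbedding
  have hmp : MeasurePreserving (reflVec v) volume volume := ⟨hcont.measurable, hmap⟩
  exact hmp.integral_comp hemb F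

theorem integral_odd_eq_zero (κ ω ε : ℝ) (k : Fin 15) {s : Poly}
    (hs : reflect (posRoot k) s = s) (c : ℝ) :
    ∫ x : Fin 3 → ℝ, eval x (C c * (linForm (posRoot k) * s)) *
      ((x ⬝ᵥ posRoot k) ^ 2 + ε)⁻¹ * regWeight κ ω ε x = 0 := by
  have h0 : posRoot k ⬝ᵥ posRoot k ≠ 0 := by rw [posRoot_dot_self]; norm_num
  have h := integral_comp_reflVec h0 fun x : Fin 3 → ℝ =>
    eval x (C c * (linForm (posRoot k) * s)) *
      ((x ⬝ᵥ posRoot k) ^ 2 + ε)⁻¹ * regWeight κ ω ε x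
  simp only [← eval_reflect, regWeight_reflVec, reflVec_dot, reflVec_self h0, dotProduct_neg,
    neg_sq, map_mul, hs, reflect_linForm, linForm_neg, algHom_C, algebraMap_eq, map_neg,
    neg_mul, mul_neg, integral_neg] at h ⊢
  linarith

theorem ae_dot_ne_zero : ∀ᵐ x : Fin 3 → ℝ, ∀ k, x ⬝ᵥ posRoot k ≠ 0 := by
  rw [ae_all_iff]
  intro k
  let S : Submodule ℝ (Fin 3 → ℝ) := LinearMap.ker (∑ i, posRoot k i • (LinearMap.proj i : (Fin 3 → ℝ) →ₗ[ℝ] ℝ))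
  have hS (x : Fin 3 → ℝ) : x ∈ S ↔ x ⬝ᵥ posRoot k = 0 := by
    simp [S, dotProduct, mul_comm]
  have htop : S ≠ ⊤ := by
    intro h
    have h1 := (hS (posRoot k)).mp (h ▸ Submodule.mem_top)
    rw [posRoot_dot_self] at h1
    norm_num at h1
  have h := Measure.addHaar_submodule volume S htop
  refine measure_mono_null (fun x hx => ?_) h
  simpa [hS] using hx

end Analysis

/-! ### Removing the regularization; the integral as an oscillator functional -/

section OscillatorIntegral

open MeasureTheory Filter Topology

theorem tendsto_integral_regWeight {κ ω : ℝ} (hκ : 0 ≤ κ) (hω : 0 < ω) (f : Poly)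
    {ε : ℕ → ℝ} (hε : ∀ n, 0 ≤ ε n) (hε1 : ∀ n, ε n ≤ 1) (hε0 : Tendsto ε atTop (𝓝 0))
    {c : ℕ → (Fin 3 → ℝ) → ℝ} (hc : ∀ n, Measurable (c n)) (hc1 : ∀ n x, |c n x| ≤ 1)
    (hlim : ∀ᵐ x, Tendsto (fun n => c n x) atTop (𝓝 1)) :
    Tendsto (fun n => ∫ x, eval x f * c n x * regWeight κ ω (ε n) x) atTop
      (𝓝 (∫ x, eval x f * regWeight κ ω 0 x)) := by
  refine tendsto_integral_of_dominated_convergence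
    (fun x => ‖eval x (f * weightBound ⌈κ⌉₊) * Real.exp (-ω * (x ⬝ᵥ x))‖)
    (fun n => (integrable_eval_mul_regWeight hκ hω (hε n) (hε1 n) f (hc n)
      (hc1 n)).aestronglyMeasurable)
    (integrable_eval_mul_gaussian hω _).norm (fun n => Eventually.of_forall fun x => ?_) ?_
  · rw [map_mul, mul_assoc (eval x f) (eval x _), norm_mul, norm_mul, norm_mul (eval x f)]
    have h1 : ‖regWeight κ ω (ε n) x‖ ≤
        ‖eval x (weightBound ⌈κ⌉₊) * Real.exp (-ω * (x ⬝ᵥ x))‖ := by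
      rw [Real.norm_of_nonneg (regWeight_nonneg κ ω (hε n) x)]
      exact (regWeight_le hκ ω (hε n) (hε1 n) x).trans (Real.le_norm_self _)
    calc ‖eval x f‖ * ‖c n x‖ * ‖regWeight κ ω (ε n) x‖
        ≤ ‖eval x f‖ * 1 * ‖eval x (weightBound ⌈κ⌉₊) * Real.exp (-ω * (x ⬝ᵥ x))‖ := by
          gcongr
          exact hc1 n x
      _ = _ := by rw [mul_one]
  · filter_upwards [hlim] with x hx
    have hw : Tendsto (fun n => regWeight κ ω (ε n) x) atTop (𝓝 (regWeight κ ω 0 x)) := by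
      unfold regWeight
      refine (tendsto_finsetProd _ fun k _ => ?_).const_mul _
      exact (hε0.const_add _).rpow_const (Or.inr hκ)
    simpa using (hx.const_mul (eval x f)).mul hw

theorem reflect_reflect {v : Fin 3 → ℝ} (hv : v ⬝ᵥ v ≠ 0) (f : Poly) :
    reflect v (reflect v f) = f := by
  refine MvPolynomial.funext fun x => ?_
  rw [eval_reflect, eval_reflect, reflVec_reflVec hv]

/-- The derivative of the weight brings in 2⟨x, v⟩fg / (⟨x, v⟩² + ε). Here 2fg is the σ-invariant s
= f·gσ + g·fσ plus ⟨x, v⟩ times divided differences. The s part is odd under the reflection and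
integrates to zero; the rest carries ⟨x, v⟩² / (⟨x, v⟩² + ε), which stays between 0 and 1. -/
theorem integral_regularized_adjoint {κ ω : ℝ} (hκ : 0 ≤ κ) (hω : 0 < ω) {ε : ℝ} (hε : 0 < ε)
    (hε1 : ε ≤ 1) (i : Fin 3) (f g : Poly) :
    (∫ x : Fin 3 → ℝ, eval x (pderiv i (f * g) - C (2 * ω) * X i * (f * g)) *
        regWeight κ ω ε x) +
      ∑ k, ∫ x : Fin 3 → ℝ, eval x (C (κ * posRoot k i) *
        (f * divDiff (posRoot k) g + g * divDiff (posRoot k) f)) *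
        ((x ⬝ᵥ posRoot k) ^ 2 * ((x ⬝ᵥ posRoot k) ^ 2 + ε)⁻¹) * regWeight κ ω ε x = 0 := by
  rw [← integral_pderiv_regWeight hκ hω hε hε1 i (f * g)]
  congr 1
  refine Finset.sum_congr rfl fun k _ => ?_
  have h0 : posRoot k ⬝ᵥ posRoot k ≠ 0 := by rw [posRoot_dot_self]; norm_num
  set s : Poly := f * reflect (posRoot k) g + g * reflect (posRoot k) f with hs_def
  set d : Poly := f * divDiff (posRoot k) g + g * divDiff (posRoot k) f with hd_def
  have hs : reflect (posRoot k) s = s := by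
    rw [hs_def, map_add, map_mul, map_mul, reflect_reflect h0, reflect_reflect h0]
    ring
  have hsplit : C (2 * κ * posRoot k i) * (linForm (posRoot k) * (f * g)) =
      C (κ * posRoot k i) * (linForm (posRoot k) * s) +
        linForm (posRoot k) ^ 2 * (C (κ * posRoot k i) * d) := by
    have hf := linForm_mul_divDiff (posRoot k) f
    have hg := linForm_mul_divDiff (posRoot k) g
    rw [mul_assoc (2 : ℝ), C_mul, map_ofNat, hs_def, hd_def]
    linear_combination (-C (κ * posRoot k i) * linForm (posRoot k)) * (g * hf + f * hg)
  have hint (p : Poly) := integrable_eval_mul_regWeight hκ hω hε.le hε1 p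
    (measurable_regularizer (posRoot k) ε) (abs_regularizer_le (posRoot k) hε)
  rw [hsplit]
  simp only [map_add, add_mul]
  rw [integral_add (hint _) (hint _), integral_odd_eq_zero κ ω ε k hs, zero_add]
  refine integral_congr_ae (Eventually.of_forall fun x => ?_)
  simp only [map_mul, map_pow, eval_linForm]
  ring

/-- Integration of polynomials against the weight `exp(-ω|x|²) h_κ(x)²`. -/
def integralLin {κ ω : ℝ} (hκ : 0 ≤ κ) (hω : 0 < ω) : Poly →ₗ[ℝ] ℝ where
  toFun f := ∫ x : Fin 3 → ℝ, eval x f * regWeight κ ω 0 x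
  map_add' f g := by
    simp only [map_add, add_mul]
    exact integral_add (integrable_eval_mul_regWeight' hκ hω le_rfl zero_le_one f)
      (integrable_eval_mul_regWeight' hκ hω le_rfl zero_le_one g)
  map_smul' c f := by
    simp only [smul_eval, mul_assoc, integral_const_mul, RingHom.id_apply, smul_eq_mul]

theorem integral_adjoint {κ ω : ℝ} (hκ : 0 ≤ κ) (hω : 0 < ω) (i : Fin 3) (f g : Poly) :
    integralLin hκ hω (dunkl κ i f * g) + integralLin hκ hω (f * dunkl κ i g) =
      2 * ω * integralLin hκ hω (X i * f * g) := by
  let ε : ℕ → ℝ := fun n => 1 / ((n : ℝ) + 1)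
  have hε (n : ℕ) : 0 < ε n := by positivity
  have hε1 (n : ℕ) : ε n ≤ 1 := by
    rw [div_le_one (by positivity)]
    linarith [Nat.cast_nonneg (α := ℝ) n]
  have hε0 : Tendsto ε atTop (𝓝 0) := tendsto_one_div_add_atTop_nhds_zero_nat
  have h1 (A : Poly) : Tendsto (fun n => ∫ x, eval x A * regWeight κ ω (ε n) x) atTop
      (𝓝 (∫ x, eval x A * regWeight κ ω 0 x)) := by
    have h := tendsto_integral_regWeight hκ hω A (fun n => (hε n).le) hε1 hε0
      (c := fun _ _ => 1) (fun _ => measurable_const) (by simp)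
      (Eventually.of_forall fun x => tendsto_const_nhds)
    simpa using h
  have h2 (B : Poly) (k : Fin 15) : Tendsto (fun n => ∫ x : Fin 3 → ℝ, eval x B *
      ((x ⬝ᵥ posRoot k) ^ 2 * ((x ⬝ᵥ posRoot k) ^ 2 + ε n)⁻¹) * regWeight κ ω (ε n) x) atTop
      (𝓝 (∫ x, eval x B * regWeight κ ω 0 x)) := by
    refine tendsto_integral_regWeight hκ hω B (fun n => (hε n).le) hε1 hε0 (fun n => ?_)
      (fun n x => ?_) ?_
    · exact ((continuous_dot _).pow 2).measurable.mul (measurable_regularizer _ _)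
    · have := hε n
      rw [abs_of_nonneg (by positivity), ← div_eq_mul_inv, div_le_one (by positivity)]
      linarith
    -- Off the mirrors, which form a null set, ⟨x, v⟩² / (⟨x, v⟩² + ε) tends to 1.
    · filter_upwards [ae_dot_ne_zero] with x hx
      have hx2 : (x ⬝ᵥ posRoot k) ^ 2 + 0 ≠ 0 := by simpa using hx k
      have h := ((hε0.const_add ((x ⬝ᵥ posRoot k) ^ 2)).inv₀ hx2).const_mul
        ((x ⬝ᵥ posRoot k) ^ 2)
      rw [add_zero] at h hx2
      rwa [mul_inv_cancel₀ hx2] at h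
  have hlim := (h1 (pderiv i (f * g) - C (2 * ω) * X i * (f * g))).add
    (tendsto_finsetSum Finset.univ fun k _ => h2 (C (κ * posRoot k i) *
        (f * divDiff (posRoot k) g + g * divDiff (posRoot k) f)) k)
  simp only [integral_regularized_adjoint hκ hω (hε _) (hε1 _)] at hlim
  have hzero := tendsto_nhds_unique hlim tendsto_const_nhds
  change integralLin hκ hω _ + ∑ k, integralLin hκ hω _ = 0 at hzero
  rw [← map_sum, ← map_add] at hzero
  rw [← smul_eq_mul (2 * ω), ← map_smul, ← map_add, ← sub_eq_zero, ← map_sub, ← hzero]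
  congr 1
  have hsum : ∑ k, C (κ * posRoot k i) *
        (f * divDiff (posRoot k) g + g * divDiff (posRoot k) f) =
      (∑ k, C (κ * posRoot k i) * divDiff (posRoot k) f) * g +
        f * ∑ k, C (κ * posRoot k i) * divDiff (posRoot k) g := by
    rw [Finset.sum_mul, Finset.mul_sum, ← Finset.sum_add_distrib]
    exact Finset.sum_congr rfl fun k _ => by ring
  rw [hsum, dunkl, dunkl, Derivation.leibniz, smul_eq_C_mul, smul_eq_mul, smul_eq_mul]
  ring

theorem integral_regWeight_pos {κ ω : ℝ} (hκ : 0 ≤ κ) (hω : 0 < ω) :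
    0 < ∫ x : Fin 3 → ℝ, regWeight κ ω 0 x := by
  have hint := integrable_eval_mul_regWeight' hκ hω le_rfl zero_le_one 1
  simp only [map_one, one_mul] at hint
  rw [integral_pos_iff_support_of_nonneg (regWeight_nonneg κ ω le_rfl) hint]
  obtain ⟨x, hx⟩ := ae_dot_ne_zero.exists
  refine (continuous_regWeight hκ ω 0).isOpen_support.measure_pos volume ⟨x, ?_⟩
  rw [Function.mem_support, regWeight]
  refine mul_ne_zero (Real.exp_ne_zero _) (Finset.prod_ne_zero_iff.mpr fun k _ => ?_)
  have := hx k
  positivity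

theorem normConst_eq (κ ω : ℝ) :
    normConst κ ω = (∫ x : Fin 3 → ℝ, regWeight κ ω 0 x)⁻¹ := by
  simp only [normConst, regWeight_zero]

theorem inner₂_eq (κ ω : ℝ) (f g : Poly) :
    inner₂ κ ω f g = normConst κ ω * ∫ x : Fin 3 → ℝ, eval x (f * g) * regWeight κ ω 0 x := by
  simp only [inner₂, regWeight_zero, map_mul, mul_assoc]

/-- Integration against the normalized weight `c_{κ,ω} exp(-ω|x|²) h_κ(x)²`. -/
def oscillatorIntegral {κ ω : ℝ} (hκ : 0 ≤ κ) (hω : 0 < ω) : OscillatorFunctional κ ω where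
  toLin := normConst κ ω • integralLin hκ hω
  map_one := by
    simp [integralLin, normConst_eq, (integral_regWeight_pos hκ hω).ne']
  map_reflect k f := by
    have h0 : posRoot k ⬝ᵥ posRoot k ≠ 0 := by rw [posRoot_dot_self]; norm_num
    have h := integral_comp_reflVec h0 fun x => eval x f * regWeight κ ω 0 x
    simp only [regWeight_reflVec, ← eval_reflect] at h
    exact congrArg (normConst κ ω * ·) h
  adjoint i f g := by
    change normConst κ ω * _ + normConst κ ω * _ = 2 * ω * (normConst κ ω * _)
    rw [← mul_add, integral_adjoint hκ hω]
    ring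

theorem oscillatorIntegral_mul {κ ω : ℝ} (hκ : 0 ≤ κ) (hω : 0 < ω) (f g : Poly) :
    (oscillatorIntegral hκ hω).toLin (f * g) = inner₂ κ ω f g :=
  (inner₂_eq κ ω f g).symm

end OscillatorIntegral

/-! ### Inner products and norms of the wavefunctions -/

theorem inner₂_w_w {κ ω : ℝ} (hκ : 0 ≤ κ) (hω : 0 < ω) (n : ℕ) (l m : Fin 12) :
    inner₂ κ ω (w κ ω n (vertex l)) (w κ ω n (vertex m)) =
      ((2 * ω) ^ n)⁻¹ * ν κ n * eval (vertex m) (q κ n (vertex l)) := by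
  rw [← oscillatorIntegral_mul hκ hω, OscillatorFunctional.map_w_mul_w _ hκ hω]

theorem inner₂_self_nonneg {κ ω : ℝ} (hκ : 0 ≤ κ) (hω : 0 < ω) (f : Poly) :
    0 ≤ inner₂ κ ω f f := by
  rw [inner₂_eq, normConst_eq]
  refine mul_nonneg (inv_nonneg.mpr (integral_regWeight_pos hκ hω).le)
    (MeasureTheory.integral_nonneg fun x => ?_)
  rw [map_mul]
  exact mul_nonneg (mul_self_nonneg _) (regWeight_nonneg κ ω le_rfl x)

theorem norm₂_sq {κ ω : ℝ} (hκ : 0 ≤ κ) (hω : 0 < ω) (f : Poly) :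
    norm₂ κ ω f ^ 2 = inner₂ κ ω f f :=
  Real.sq_sqrt (inner₂_self_nonneg hκ hω f)

end IcosahedralOscillator

end

theorem mainTheorem8 (κ ω : ℝ) (hκ : 0 ≤ κ) (hω : 0 < ω)
    (y₀ : Fin 3 → ℝ) (hy₀ : y₀ ∈ IcosahedralOscillator.icosahedron) :
    (∀ n : ℕ, IcosahedralOscillator.w κ ω n y₀ =
      ∑ j ∈ Finset.range (n / 2 + 1),
        MvPolynomial.C ((-1) ^ j *
            ((IcosahedralOscillator.τ + 2) ^ j / ((4 * ω) ^ j * (j.factorial : ℝ))) *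
            (IcosahedralOscillator.ν κ n / IcosahedralOscillator.ν κ (n - 2 * j))) *
          IcosahedralOscillator.q κ (n - 2 * j) y₀) ∧
    (∀ n : ℕ,
      IcosahedralOscillator.norm₂ κ ω (IcosahedralOscillator.w κ ω (2 * n) y₀) ^ 2 =
        ((2 * ω) ^ (2 * n))⁻¹ * IcosahedralOscillator.ν κ (2 * n) *
          IcosahedralOscillator.τ ^ (2 * n) * IcosahedralOscillator.Y0 κ n) ∧
    (∀ n : ℕ,
      IcosahedralOscillator.norm₂ κ ω (IcosahedralOscillator.w κ ω (2 * n + 1) y₀) ^ 2 =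
        ((2 * ω) ^ (2 * n + 1))⁻¹ * IcosahedralOscillator.ν κ (2 * n + 1) *
          (IcosahedralOscillator.τ + 2) * IcosahedralOscillator.τ ^ (2 * n) *
          IcosahedralOscillator.Y0 κ n) ∧
    (∀ y₁ ∈ IcosahedralOscillator.icosahedron,
      dotProduct y₀ y₁ = IcosahedralOscillator.τ →
      (∀ n : ℕ,
        IcosahedralOscillator.inner₂ κ ω (IcosahedralOscillator.w κ ω (2 * n) y₀)
            (IcosahedralOscillator.w κ ω (2 * n) y₁) =
          ((2 * ω) ^ (2 * n))⁻¹ * IcosahedralOscillator.ν κ (2 * n) *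
            IcosahedralOscillator.τ ^ (2 * n) * IcosahedralOscillator.Y1 κ n) ∧
      (∀ n : ℕ,
        IcosahedralOscillator.inner₂ κ ω (IcosahedralOscillator.w κ ω (2 * n + 1) y₀)
            (IcosahedralOscillator.w κ ω (2 * n + 1) y₁) =
          ((2 * ω) ^ (2 * n + 1))⁻¹ * IcosahedralOscillator.ν κ (2 * n + 1) *
            IcosahedralOscillator.τ ^ (2 * n + 1) * IcosahedralOscillator.Y1 κ n)) := by
  obtain ⟨m, rfl⟩ := hy₀
  refine ⟨fun n => IcosahedralOscillator.w_eq hκ ω n m, fun n => ?_, fun n => ?_, ?_⟩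
  · rw [IcosahedralOscillator.norm₂_sq hκ hω, IcosahedralOscillator.inner₂_w_w hκ hω,
      IcosahedralOscillator.eval_q_even_self]
    ring
  · rw [IcosahedralOscillator.norm₂_sq hκ hω, IcosahedralOscillator.inner₂_w_w hκ hω,
      IcosahedralOscillator.eval_q_odd_self]
    ring
  · rintro _ ⟨l, rfl⟩ h
    -- The polynomial attached to y₀ is evaluated at y₁, so the roles of the two vertices are
    -- exchanged.
    rw [dotProduct_comm] at h
    refine ⟨fun n => ?_, fun n => ?_⟩
    · rw [IcosahedralOscillator.inner₂_w_w hκ hω,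
        IcosahedralOscillator.eval_q_even_neighbor κ n l m h]
      ring
    · rw [IcosahedralOscillator.inner₂_w_w hκ hω,
        IcosahedralOscillator.eval_q_odd_neighbor κ n l m h]
      ring
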